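/- Let $V\subset\mathbb R^3$ be a bounded convex domain, $\mathbb S^2$ the unit sphere, and let $\sigma=\sigma_S+\sigma_A$ on $V$, where the measurable functions $\sigma_S,\sigma_A$ on $V$ are bounded above and below by strictly positive constants. Let $\sigma_{\min}>0$ satisfy $\sigma_{\min}\le\sigma(\mathbf r)$ for all $\mathbf r\in V$. For a function $\psi(\mathbf r,\Omega)$ put $$\mathcal T\psi(\mathbf r,\Omega)=\Omega\cdot\nabla\psi(\mathbf r,\Omega)+\sigma(\mathbf r)\psi(\mathbf r,\Omega),$$ where $\Omega\cdot\nabla$ is the derivative in the direction $\Omega$ with respect to $\mathbf r$. Its scalar flux is $\phi(\mathbf r)=\frac1{4\pi}\int_{\mathbb S^2}\psi(\mathbf r,\Omega)\,d\Omega$. The vacuum boundary condition is $\psi(\mathbf r,\Omega)=0$ whenever $\mathbf r\in\partial V$ and $\mathbf n(\mathbf r)\cdot\Omega<0$, with $\mathbf n$ the outward normal (for all outward normals at $\mathbf r$, if there are several); the set of such $\mathbf r$ is the inflow boundary for the direction $\Omega$. For a function $q$ on $V$ (which may depend on $\psi$), a solution of $\mathcal T\psi=q$ with vacuum boundary conditions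 is a function $\psi$, square integrable on $V\times\mathbb S^2$, such that for almost every $(\mathbf r,\Omega)\in V\times\mathbb S^2$ the following holds on the line $s\mapsto\mathbf r+s\Omega$: $\psi(\cdot,\Omega)$ is absolutely continuous on every compact segment of the line contained in the union of $V$ and the inflow boundary for $\Omega$, it satisfies $\mathcal T\psi=q$ at almost every point of the line in $V$, and it vanishes at the points of the line on the inflow boundary. (i) For every $g\in L^2(V)$ the pure transport problem $\mathcal T\psi=g$ with vacuum boundary conditions has a solution $\psi$, unique up to equality almost everywhere on $V\times\mathbb S^2$, and its scalar flux satisfies $\phi\in L^2(V)$ and $$\|\phi\|_{L^2(V)}\le\frac1{\sigma_{\min}}\|g\|_{L^2(V)}.$$ (ii) One has $\|\sigma_S/\sigma\|_{L^\infty(V)}<1$. For every $Q\in L^2(V)$ the radiative transport equation $$\Omega\cdot\nabla\psi(\mathbf r,\Omega)+\sigma(\mathbf r)\psi(\mathbf r,\Omega)=\frac{\sigma_S(\mathbf r)}{4\pi}\int_{\mathbb S^2}\psi(\mathbf r,\Omega')\,d\Omega'+Q(\mathbf r)$$ with vacuum boundary conditions has a solution $\psi$, unique up to equality almost everywhere on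 $V\times\mathbb S^2$, and its scalar flux satisfies $\phi\in L^2(V)$ and $$\|\phi\|_{L^2(V)}\le\frac1{\sigma_{\min}}\left(1-\left\|\frac{\sigma_S}{\sigma}\right\|_{L^\infty(V)}\right)^{-1}\|Q\|_{L^2(V)}.$$ -/

import Mathlib

open MeasureTheory Set
open scoped ENNReal

namespace Transport

noncomputable section

/-- Euclidean three-space. -/
abbrev R3 : Type := EuclideanSpace ℝ (Fin 3)

/-- The unit sphere of directions. -/
abbrev S2 : Type := Metric.sphere (0 : R3) 1

/-- The surface measure on the unit sphere (total mass `4 * π`). -/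
def surfaceMeasure : Measure S2 := (volume : Measure R3).toSphere

/-- The product of Lebesgue measure on `V` and surface measure on the sphere. -/
def phaseMeasure (V : Set R3) : Measure (R3 × S2) :=
  (volume.restrict V).prod surfaceMeasure

/-- The unit outward normals of a convex set `V` at a point `b`. At a boundary point where the
boundary of `V` is smooth there is exactly one. -/
def outwardNormals (V : Set R3) (b : R3) : Set R3 :=
  {n | ‖n‖ = 1 ∧ ∀ v ∈ V, inner ℝ n (v - b) ≤ 0}

/-- The inflow boundary for the direction `Ω`: the boundary points `b` with `n(b) · Ω < 0`
(for every outward normal, if there are several at an edge or a corner). -/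
def inflowBoundary (V : Set R3) (Ω : S2) : Set R3 :=
  {b | b ∈ frontier V ∧ ∀ n ∈ outwardNormals V b, inner ℝ n (Ω : R3) < 0}

/-- The transport operator `(T ψ)(r, Ω) = Ω · ∇ψ(r, Ω) + σ(r) ψ(r, Ω)`, where `Ω · ∇` is the
derivative in the direction `Ω` with respect to `r`. -/
def transportOp (σ : R3 → ℝ) (ψ : R3 → S2 → ℝ) (r : R3) (Ω : S2) : ℝ :=
  lineDeriv ℝ (fun y => ψ y Ω) r (Ω : R3) + σ r * ψ r Ω

/-- The scalar flux `φ(r) = (1 / 4π) ∫ ψ(r, Ω) dΩ`. -/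
def scalarFlux (ψ : R3 → S2 → ℝ) (r : R3) : ℝ :=
  1 / (4 * Real.pi) * ∫ Ω, ψ r Ω ∂surfaceMeasure

/-- Along the characteristic line `s ↦ r + s Ω`, the function `ψ(·, Ω)` is absolutely continuous in
`V`, up to and including the inflow boundary; it satisfies `T ψ = q` at almost every point of the
line in `V`; and it vanishes on the inflow boundary. -/
structure SolvesAlong (V : Set R3) (σ q : R3 → ℝ) (ψ : R3 → S2 → ℝ) (r : R3) (Ω : S2) :
    Prop where
  absolutelyContinuous : ∀ a b : ℝ, a ≤ b →
    (∀ s ∈ Icc a b, r + s • (Ω : R3) ∈ V ∪ inflowBoundary V Ω) →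
    AbsolutelyContinuousOnInterval (fun s : ℝ => ψ (r + s • (Ω : R3)) Ω) a b
  equation : ∀ᵐ s : ℝ, r + s • (Ω : R3) ∈ V →
    transportOp σ ψ (r + s • (Ω : R3)) Ω = q (r + s • (Ω : R3))
  vacuum : ∀ s : ℝ, r + s • (Ω : R3) ∈ inflowBoundary V Ω → ψ (r + s • (Ω : R3)) Ω = 0

/-- `ψ` is a square integrable solution of the pure transport problem `T ψ = q` in `V × S²` with
the vacuum boundary condition `ψ = 0` on the inflow boundary: it solves the problem along the
characteristic line through `(r, Ω)`, for almost every `(r, Ω)`. -/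
structure IsTransportSolution (V : Set R3) (σ q : R3 → ℝ) (ψ : R3 → S2 → ℝ) : Prop where
  memLp : MemLp (Function.uncurry ψ) 2 (phaseMeasure V)
  solvesAlong : ∀ᵐ p ∂(phaseMeasure V), SolvesAlong V σ q ψ p.1 p.2

/-- `ψ` is a square integrable solution of the radiative transport equation
`Ω · ∇ψ + σ ψ = (σS / 4π) ∫ ψ dΩ' + Q` with the vacuum boundary condition. -/
def IsRTESolution (V : Set R3) (σ σS Q : R3 → ℝ) (ψ : R3 → S2 → ℝ) : Prop :=
  IsTransportSolution V σ (fun r => σS r * scalarFlux ψ r + Q r) ψ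

/-- The `L²(V)` norm. -/
def normL2 (V : Set R3) (f : R3 → ℝ) : ℝ := (eLpNorm f 2 (volume.restrict V)).toReal

/-- The `L^∞(V)` norm (essential supremum). -/
def normLinf (V : Set R3) (f : R3 → ℝ) : ℝ := (eLpNorm f ∞ (volume.restrict V)).toReal

end

end Transport

namespace Transport

/-! ### The transport equation on a line -/

/-! Everything rests on one weighted energy estimate. Along a characteristic the equation reads `f'
+ S f = q` with `f = 0` at the inflow end, and `q² / S - S f² - (f²)' = f'² / S ≥ 0`. Integrating
along the chord and dropping the outflow term gives `∫ S f² ≤ ∫ q² / S` (`energy_estimate_Ioo`).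

By Fubini and translation invariance, an integral over `V` is an average of chord integrals
(`setLIntegral_eq_average_chord`). Hence the line estimate becomes `‖√σ ψ‖ ≤ ‖q / √σ‖` on phase
space. Since `σ` and `q` do not depend on direction, Cauchy–Schwarz on the sphere turns this into
`‖√σ φ‖ ≤ ‖q / √σ‖` on `V` (`eLpNorm_sqrt_mul_scalarFlux_le`). Removing the two weights costs
`σmin^(-1/2)` each, which is the bound in (i). Uniqueness is the case of zero source, and existence
comes from the explicit integral along characteristics.

For (ii) the source is `σS φ + Q`, and `σS φ / √σ = (σS / σ) (√σ φ)`. In the norm `‖√σ ·‖` the map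
from assumed to resulting flux therefore contracts with constant `c = ‖σS / σ‖_∞ < 1`; the
unweighted norm would only give `‖σS‖_∞ / σmin`, which may exceed one. Banach's theorem gives
existence, the contraction gives uniqueness, and absorbing `c ‖√σ φ‖` on the left gives the bound.
-/

theorem energy_estimate_Icc {f S q : ℝ → ℝ} {a b m M : ℝ} (hab : a ≤ b) (hm : 0 < m)
    (hS : Measurable S) (hSm : ∀ s, m ≤ S s) (hSM : ∀ s, S s ≤ M) (hq : Measurable q)
    (hf : AbsolutelyContinuousOnInterval f a b) (h0 : f a = 0)
    (heq : ∀ᵐ s, s ∈ Ioc a b → deriv f s + S s * f s = q s) :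
    ∫⁻ s in Ioc a b, ENNReal.ofReal (S s * f s ^ 2) ≤
      ∫⁻ s in Ioc a b, ENNReal.ofReal (q s ^ 2 / S s) := by
  have hSpos : ∀ s, 0 < S s := fun s => hm.trans_le (hSm s)
  by_cases htop : ∫⁻ s in Ioc a b, ENNReal.ofReal (q s ^ 2 / S s) = ⊤
  · rw [htop]; exact le_top
  have hqint : IntegrableOn (fun s => q s ^ 2 / S s) (Ioc a b) := by
    refine ⟨((hq.pow_const 2).div hS).aestronglyMeasurable, ?_⟩
    rw [hasFiniteIntegral_iff_ofReal
      (Filter.Eventually.of_forall fun s => div_nonneg (sq_nonneg _) (hSpos s).le)]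
    exact lt_top_iff_ne_top.2 htop
  have hcont : ContinuousOn (fun s => f s ^ 2) (Icc a b) := by
    have := hf.continuousOn
    rw [uIcc_of_le hab] at this
    exact this.pow 2
  have hfint : IntegrableOn (fun s => S s * f s ^ 2) (Ioc a b) := by
    refine Integrable.bdd_mul (c := M) ((hcont.integrableOn_Icc).mono_set Ioc_subset_Icc_self)
      hS.aestronglyMeasurable (Filter.Eventually.of_forall fun s => ?_)
    rw [Real.norm_of_nonneg (hSpos s).le]
    exact hSM s
  -- The fundamental theorem of calculus for the absolutely continuous function `f²`.
  have hder := (hf.fun_mul hf).integral_deriv_eq_sub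
  have hderint := (hf.fun_mul hf).intervalIntegrable_deriv
  rw [intervalIntegrable_iff_integrableOn_Ioc_of_le hab] at hderint
  rw [intervalIntegral.integral_of_le hab, h0] at hder
  have hle : ∫ s in Ioc a b, deriv (fun x => f x * f x) s ≤
      ∫ s in Ioc a b, (q s ^ 2 / S s - S s * f s ^ 2) := by
    refine setIntegral_mono_on_ae hderint (hqint.sub hfint) measurableSet_Ioc ?_
    filter_upwards [heq, hf.ae_differentiableAt] with s hs hd hmem
    have hd' := hd (by rw [uIcc_of_le hab]; exact Ioc_subset_Icc_self hmem)
    rw [deriv_fun_mul hd' hd', ← hs hmem]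
    have h1 : (deriv f s + S s * f s) ^ 2 / S s - S s * f s ^ 2 -
        (deriv f s * f s + f s * deriv f s) = deriv f s ^ 2 / S s := by
      have := (hSpos s).ne'
      field_simp
      ring
    have h2 : 0 ≤ deriv f s ^ 2 / S s := div_nonneg (sq_nonneg _) (hSpos s).le
    linarith
  rw [integral_sub hqint hfint] at hle
  -- The boundary contribution is `f(b)² - f(a)² = f(b)² ≥ 0`: outflow only helps.
  have h3 : ∫ s in Ioc a b, S s * f s ^ 2 ≤ ∫ s in Ioc a b, q s ^ 2 / S s := by
    nlinarith [mul_self_nonneg (f b)]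
  rw [← ofReal_integral_eq_lintegral_ofReal hfint
      (Filter.Eventually.of_forall fun s => mul_nonneg (hSpos s).le (sq_nonneg _)),
    ← ofReal_integral_eq_lintegral_ofReal hqint
      (Filter.Eventually.of_forall fun s => div_nonneg (sq_nonneg _) (hSpos s).le)]
  exact ENNReal.ofReal_le_ofReal h3

/-- Nothing is known about `f` at the outflow end `b`, so the closed estimate is applied on `[a, c]`
and `c` tends to `b` from below. -/
theorem energy_estimate_Ioo {f S q : ℝ → ℝ} {a b m M : ℝ} (hab : a < b) (hm : 0 < m)
    (hS : Measurable S) (hSm : ∀ s, m ≤ S s) (hSM : ∀ s, S s ≤ M) (hq : Measurable q)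
    (hf : ∀ c ∈ Ioo a b, AbsolutelyContinuousOnInterval f a c) (h0 : f a = 0)
    (heq : ∀ᵐ s, s ∈ Ioo a b → deriv f s + S s * f s = q s) :
    ∫⁻ s in Ioo a b, ENNReal.ofReal (S s * f s ^ 2) ≤
      ∫⁻ s in Ioo a b, ENNReal.ofReal (q s ^ 2 / S s) := by
  have hcov : AECover (volume.restrict (Ioo a b)) (nhdsWithin b (Iio b)) fun c => Ioc a c :=
    aecover_Ioo_of_Ioc tendsto_const_nhds
      (Filter.tendsto_id.mono_left nhdsWithin_le_nhds)
  have hev : ∀ᶠ c in nhdsWithin b (Iio b), c ∈ Ioo a b := Ioo_mem_nhdsLT hab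
  have hfc : ContinuousOn f (Ioo a b) := by
    intro s hs
    obtain ⟨c, hc1, hc2⟩ := exists_between hs.2
    have := (hf c ⟨hs.1.trans hc1, hc2⟩).continuousOn
    rw [uIcc_of_le (hs.1.trans hc1).le] at this
    exact (this.continuousAt (Icc_mem_nhds hs.1 hc1)).continuousWithinAt
  have hmeas : AEMeasurable (fun s => ENNReal.ofReal (S s * f s ^ 2))
      (volume.restrict (Ioo a b)) :=
    (hS.aemeasurable.mul ((hfc.aemeasurable measurableSet_Ioo).pow_const 2)).ennreal_ofReal
  refine le_of_tendsto (hcov.lintegral_tendsto_of_countably_generated hmeas) ?_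
  filter_upwards [hev] with c hc
  have hsub : Ioc a c ⊆ Ioo a b := fun s hs => ⟨hs.1, hs.2.trans_lt hc.2⟩
  rw [Measure.restrict_restrict measurableSet_Ioc, inter_eq_left.2 hsub]
  refine (energy_estimate_Icc hc.1.le hm hS hSm hSM hq (hf c hc) h0 ?_).trans
    (lintegral_mono_set hsub)
  filter_upwards [heq] with s hs hmem using hs (hsub hmem)

/-- The solution of `f' + S f = G` on the line that vanishes at `-∞`. -/
noncomputable def attenuated (S G : ℝ → ℝ) (s : ℝ) : ℝ :=
  ∫ t in Ioi 0, Real.exp (-∫ u in (0 : ℝ)..t, S (s - u)) * G (s - t)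

theorem intervalIntegrable_of_bounded {S : ℝ → ℝ} {M : ℝ} (hS : Measurable S)
    (hSM : ∀ s, |S s| ≤ M) (a b : ℝ) : IntervalIntegrable S volume a b :=
  (intervalIntegrable_const (c := M)).mono_fun hS.aestronglyMeasurable
    (Filter.Eventually.of_forall fun s => by
      simpa using (hSM s).trans (le_abs_self M))

theorem locallyIntegrable_of_bounded {S : ℝ → ℝ} {M : ℝ} (hS : Measurable S)
    (hSM : ∀ s, |S s| ≤ M) : LocallyIntegrable S :=
  (locallyIntegrable_const M).mono hS.aestronglyMeasurable
    (Filter.Eventually.of_forall fun s => by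
      simpa using (hSM s).trans (le_abs_self M))

section Attenuated

variable {S G : ℝ → ℝ} {M : ℝ}

/-- The integrating factor form: the optical depth between `t` and `s` is a difference of two values
of one primitive, so the dependence on `s` factors out of the integrand. -/
theorem attenuated_eq (hS : Measurable S) (hSM : ∀ s, |S s| ≤ M) (s : ℝ) :
    attenuated S G s = Real.exp (-∫ u in (0 : ℝ)..s, S u) *
      ∫ t in Iic s, Real.exp (∫ u in (0 : ℝ)..t, S u) * G t := by
  have hii := intervalIntegrable_of_bounded hS hSM
  rw [attenuated, integral_Iic_eq_integral_Iio, ← integral_const_mul,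
    ← integral_indicator measurableSet_Ioi, ← integral_indicator measurableSet_Iio,
    ← integral_sub_left_eq_self _ volume s]
  refine integral_congr_ae (Filter.Eventually.of_forall fun t => ?_)
  by_cases ht : t < s
  · have h1 : t ∈ Iio s := ht
    have h2 : s - t ∈ Ioi (0 : ℝ) := by simpa using ht
    simp only [indicator_of_mem h1, indicator_of_mem h2, sub_sub_cancel]
    rw [← mul_assoc, ← Real.exp_add, intervalIntegral.integral_comp_sub_left, sub_zero,
      sub_sub_cancel, ← intervalIntegral.integral_interval_sub_left (hii 0 s) (hii 0 t)]
    congr 2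
    ring
  · have h1 : t ∉ Iio s := ht
    have h2 : s - t ∉ Ioi (0 : ℝ) := by simpa using ht
    simp only [indicator_of_notMem h1, indicator_of_notMem h2]

theorem continuous_primitive_of_bounded (hS : Measurable S) (hSM : ∀ s, |S s| ≤ M) :
    Continuous fun t => ∫ u in (0 : ℝ)..t, S u :=
  intervalIntegral.continuous_primitive (intervalIntegrable_of_bounded hS hSM) 0

/-- Since `S ≥ 0`, the primitive is increasing, so the exponential weight is bounded on the whole
half-line by its value at `s`. -/
theorem integrableOn_Iic_exp_mul (hS : Measurable S) (hS0 : ∀ s, 0 ≤ S s)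
    (hSM : ∀ s, |S s| ≤ M) (hG : Integrable G) (s : ℝ) :
    IntegrableOn (fun t => Real.exp (∫ u in (0 : ℝ)..t, S u) * G t) (Iic s) := by
  have hii := intervalIntegrable_of_bounded hS hSM
  refine Integrable.bdd_mul (c := Real.exp (∫ u in (0 : ℝ)..s, S u)) hG.integrableOn
    (continuous_primitive_of_bounded hS hSM).rexp.aestronglyMeasurable ?_
  filter_upwards [ae_restrict_mem measurableSet_Iic] with t ht
  rw [Real.norm_of_nonneg (Real.exp_pos _).le, Real.exp_le_exp, ← sub_nonneg,
    intervalIntegral.integral_interval_sub_left (hii 0 s) (hii 0 t)]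
  exact intervalIntegral.integral_nonneg ht fun u _ => hS0 u

theorem attenuated_eq_add (hS : Measurable S) (hS0 : ∀ s, 0 ≤ S s)
    (hSM : ∀ s, |S s| ≤ M) (hG : Integrable G) (a s : ℝ) :
    attenuated S G s = Real.exp (-∫ u in (0 : ℝ)..s, S u) *
      ((∫ t in Iic a, Real.exp (∫ u in (0 : ℝ)..t, S u) * G t) +
        ∫ t in a..s, Real.exp (∫ u in (0 : ℝ)..t, S u) * G t) := by
  have hI := integrableOn_Iic_exp_mul hS hS0 hSM hG
  rw [attenuated_eq hS hSM, ← intervalIntegral.integral_Iic_sub_Iic (hI a) (hI s)]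
  ring

theorem locallyIntegrable_exp_mul (hS : Measurable S) (hSM : ∀ s, |S s| ≤ M)
    (hG : Integrable G) :
    LocallyIntegrable fun t => Real.exp (∫ u in (0 : ℝ)..t, S u) * G t := by
  exact hG.locallyIntegrable.continuous_smul
    (continuous_primitive_of_bounded hS hSM).rexp

theorem absolutelyContinuousOnInterval_attenuated (hS : Measurable S) (hS0 : ∀ s, 0 ≤ S s)
    (hSM : ∀ s, |S s| ≤ M) (hG : Integrable G) (a b : ℝ) :
    AbsolutelyContinuousOnInterval (attenuated S G) a b := by
  have hii := intervalIntegrable_of_bounded hS hSM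
  have hA : AbsolutelyContinuousOnInterval
      (fun s => Real.exp (-∫ u in (0 : ℝ)..s, S u)) a b := by
    have hcont := continuous_primitive_of_bounded hS hSM
    obtain ⟨C, hC⟩ := isCompact_uIcc.exists_bound_of_continuousOn (hcont.neg.continuousOn
      (s := uIcc a b))
    -- The exponential is Lipschitz only on compact sets, hence the prior bound `C` on the exponent
    -- over the interval.
    obtain ⟨K, hK⟩ := (Real.contDiff_exp (n := 1)).contDiffOn.exists_lipschitzOnWith
      (by decide) (convex_Icc (-C) C) isCompact_Icc
    have hlip : LipschitzWith (Real.toNNReal M) fun s => -∫ u in (0 : ℝ)..s, S u := by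
      refine LipschitzWith.of_dist_le_mul fun x y => ?_
      rw [dist_neg_neg, Real.dist_eq,
        intervalIntegral.integral_interval_sub_left (hii 0 x) (hii 0 y), Real.dist_eq]
      refine (intervalIntegral.norm_integral_le_of_norm_le_const (f := S) (C := M) fun u _ => hSM u).trans ?_
      gcongr
      exact Real.le_coe_toNNReal M
    exact (hK.comp hlip.lipschitzOnWith fun s hs =>
      abs_le.1 (hC s hs)).absolutelyContinuousOnInterval
  have hB : AbsolutelyContinuousOnInterval
      (fun s => ∫ t in a..s, Real.exp (∫ u in (0 : ℝ)..t, S u) * G t) a b :=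
    (((locallyIntegrable_exp_mul hS hSM hG).integrableOn_isCompact
      isCompact_uIcc).intervalIntegrable).absolutelyContinuousOnInterval_intervalIntegral
      left_mem_uIcc
  have hC : AbsolutelyContinuousOnInterval
      (fun _ : ℝ => ∫ t in Iic a, Real.exp (∫ u in (0 : ℝ)..t, S u) * G t) a b :=
    (LipschitzWith.const _).lipschitzOnWith.absolutelyContinuousOnInterval
  have := hA.mul (hC.add hB)
  convert this using 1
  funext s
  exact attenuated_eq_add hS hS0 hSM hG a s

/-- Lebesgue differentiation applies at almost every point to both primitives, that of `S` and that
of the weighted source; the product rule then gives the equation. -/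
theorem ae_hasDerivAt_attenuated (hS : Measurable S) (hS0 : ∀ s, 0 ≤ S s)
    (hSM : ∀ s, |S s| ≤ M) (hG : Integrable G) :
    ∀ᵐ s, HasDerivAt (attenuated S G) (G s - S s * attenuated S G s) s := by
  filter_upwards [_root_.LocallyIntegrable.ae_hasDerivAt_integral (locallyIntegrable_of_bounded hS hSM),
    _root_.LocallyIntegrable.ae_hasDerivAt_integral (locallyIntegrable_exp_mul hS hSM hG)] with s h1 h2
  have hd := ((h1 0).neg.exp).mul ((h2 0).const_add
    (∫ t in Iic 0, Real.exp (∫ u in (0 : ℝ)..t, S u) * G t))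
  have hfun : attenuated S G = fun s => _ := funext (attenuated_eq_add hS hS0 hSM hG 0)
  rw [hfun]
  refine hd.congr_deriv ?_
  have : Real.exp (-∫ u in (0 : ℝ)..s, S u) * Real.exp (∫ u in (0 : ℝ)..s, S u) = 1 := by
    rw [← Real.exp_add]; simp
  simp only [Pi.neg_apply]
  linear_combination G s * this

theorem attenuated_eq_zero {s : ℝ} (h : ∀ t < s, G t = 0) : attenuated S G s = 0 := by
  rw [attenuated]
  refine setIntegral_eq_zero_of_forall_eq_zero fun t ht => ?_
  rw [h _ (by simpa using ht), mul_zero]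

end Attenuated

/-! ### Chords of a convex domain -/

section Chords

variable {V : Set R3}

/-- The parameters at which the line through `r` in the direction `Ω` lies in `V`. -/
def chord (V : Set R3) (r : R3) (Ω : S2) : Set ℝ := {s | r + s • (Ω : R3) ∈ V}

theorem norm_direction (Ω : S2) : ‖(Ω : R3)‖ = 1 := by simp

theorem isOpen_chord (hV : IsOpen V) (r : R3) (Ω : S2) : IsOpen (chord V r Ω) :=
  hV.preimage (f := fun s : ℝ => r + s • (Ω : R3)) (by fun_prop)

theorem ordConnected_chord (hV : Convex ℝ V) (r : R3) (Ω : S2) : (chord V r Ω).OrdConnected := by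
  have h : Convex ℝ (chord V r Ω) := by
    intro s hs t ht a b ha hb hab
    have := hV hs ht ha hb hab
    have e : r + (a • s + b • t) • (Ω : R3) = a • (r + s • (Ω : R3)) + b • (r + t • (Ω : R3)) := by
      have : r = (a + b) • r := by rw [hab, one_smul]
      simp only [smul_eq_mul]
      nth_rewrite 1 [this]
      module
    change r + (a • s + b • t) • (Ω : R3) ∈ V
    rwa [e]
  exact h.ordConnected

theorem exists_norm_sub_le_of_isBounded (hV : Bornology.IsBounded V) :
    ∃ D : ℝ, ∀ x ∈ V, ∀ y ∈ V, ‖x - y‖ ≤ D := by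
  obtain ⟨D, hD⟩ := Metric.isBounded_iff.1 hV
  exact ⟨D, fun x hx y hy => by rw [← dist_eq_norm]; exact hD hx hy⟩

theorem isBounded_chord (hV : Bornology.IsBounded V) (r : R3) (Ω : S2) :
    Bornology.IsBounded (chord V r Ω) := by
  obtain ⟨D, hD⟩ := exists_norm_sub_le_of_isBounded hV
  refine Metric.isBounded_iff.2 ⟨D, fun s hs t ht => ?_⟩
  have := hD _ hs _ ht
  rwa [add_sub_add_left_eq_sub, ← sub_smul, norm_smul, norm_direction, mul_one,
    ← dist_eq_norm] at this

theorem exists_chord_eq_Ioo (hVo : IsOpen V) (hVc : Convex ℝ V) (hVb : Bornology.IsBounded V)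
    {r : R3} (hr : r ∈ V) (Ω : S2) : ∃ a b : ℝ, a < b ∧ chord V r Ω = Ioo a b := by
  have ho := isOpen_chord hVo r Ω
  have hb := isBounded_chord hVb r Ω
  have hne : (chord V r Ω).Nonempty := ⟨0, by simpa [chord] using hr⟩
  have hconn : IsConnected (chord V r Ω) := ⟨hne, (ordConnected_chord hVc r Ω).isPreconnected⟩
  have heq : chord V r Ω = Ioo (sInf (chord V r Ω)) (sSup (chord V r Ω)) := by
    -- An open set of reals contains neither its infimum nor its supremum.
    refine Subset.antisymm (fun s hs => ?_) (hconn.Ioo_csInf_csSup_subset hb.bddBelow hb.bddAbove)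
    obtain ⟨ε, hε, hball⟩ := Metric.isOpen_iff.1 ho s hs
    have h1 : s - ε / 2 ∈ chord V r Ω := hball (by
      rw [Metric.mem_ball, Real.dist_eq, abs_lt]; constructor <;> linarith)
    have h2 : s + ε / 2 ∈ chord V r Ω := hball (by
      rw [Metric.mem_ball, Real.dist_eq, abs_lt]; constructor <;> linarith)
    constructor
    · linarith [csInf_le hb.bddBelow h1]
    · linarith [le_csSup hb.bddAbove h2]
  refine ⟨_, _, ?_, heq⟩
  rw [heq] at hne
  exact nonempty_Ioo.1 hne

/-- By openness one may step from `b + tΩ` a little further along a unit normal `n` and stay in `V`.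
The normal inequality at that point reads `t n·Ω + ε/2 ≤ 0`, which forces `n·Ω < 0`. -/
theorem mem_inflowBoundary_of_mem_closure (hVo : IsOpen V) {b : R3} {Ω : S2}
    (hb : b ∈ closure V) (hbV : b ∉ V) {t : ℝ} (ht : 0 < t) (htV : b + t • (Ω : R3) ∈ V) :
    b ∈ inflowBoundary V Ω := by
  refine ⟨⟨hb, by rwa [hVo.interior_eq]⟩, fun n hn => ?_⟩
  obtain ⟨ε, hε, hball⟩ := Metric.isOpen_iff.1 hVo _ htV
  have hmem : b + t • (Ω : R3) + (ε / 2) • n ∈ V := hball (by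
    rw [Metric.mem_ball, dist_eq_norm, add_sub_cancel_left, norm_smul, hn.1, mul_one,
      Real.norm_of_nonneg (by linarith)]
    linarith)
  have h := hn.2 _ hmem
  rw [show b + t • (Ω : R3) + (ε / 2) • n - b = t • (Ω : R3) + (ε / 2) • n by abel,
    inner_add_right, inner_smul_right, inner_smul_right, real_inner_self_eq_norm_sq, hn.1] at h
  by_contra! hcon
  nlinarith [mul_nonneg ht.le hcon]

/-- A separating hyperplane at `b` provides a normal `n` with `n·(v - b) < 0` on `V`. If `b - tΩ`
were in `V`, then `n·Ω > 0`, against inflow. Thus everything upstream of an inflow point lies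
outside `V`, which is why the explicit solution vanishes there. -/
theorem notMem_of_mem_inflowBoundary (hVo : IsOpen V) (hVc : Convex ℝ V) {b : R3} {Ω : S2}
    (hb : b ∈ inflowBoundary V Ω) {t : ℝ} (ht : 0 < t) : b - t • (Ω : R3) ∉ V := by
  intro hmem
  have hbV : b ∉ V := by
    have := hb.1.2
    rwa [hVo.interior_eq] at this
  obtain ⟨f, hf⟩ := geometric_hahn_banach_open_point hVc hVo hbV
  set n := (InnerProductSpace.toDual ℝ R3).symm f with hn
  have hfn : ∀ v, inner ℝ n v = f v := fun v => InnerProductSpace.toDual_symm_apply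
  have hneg : ∀ v ∈ V, inner ℝ n (v - b) < 0 := fun v hv => by
    rw [hfn, map_sub]
    linarith [hf v hv]
  have hn0 : n ≠ 0 := by
    intro h0
    have := hneg _ hmem
    rw [h0, inner_zero_left] at this
    exact lt_irrefl _ this
  have hnpos : 0 < ‖n‖ := norm_pos_iff.2 hn0
  have hout : ‖n‖⁻¹ • n ∈ outwardNormals V b := by
    refine ⟨by rw [norm_smul, norm_inv, norm_norm, inv_mul_cancel₀ hnpos.ne'], fun v hv => ?_⟩
    rw [real_inner_smul_left]
    exact mul_nonpos_of_nonneg_of_nonpos (inv_nonneg.2 hnpos.le) (hneg v hv).le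
  have h1 := hb.2 _ hout
  rw [real_inner_smul_left] at h1
  have h2 : inner ℝ n (Ω : R3) < 0 := by
    by_contra! hcon
    linarith [mul_nonneg (inv_nonneg.2 hnpos.le) hcon]
  have h3 := hneg _ hmem
  rw [sub_sub_cancel_left, inner_neg_right, inner_smul_right] at h3
  nlinarith

/-- A chord issues from the inflow boundary. -/
theorem exists_chord_eq_Ioo_inflow (hVo : IsOpen V) (hVc : Convex ℝ V)
    (hVb : Bornology.IsBounded V) {r : R3} (hr : r ∈ V) (Ω : S2) :
    ∃ a b : ℝ, a < b ∧ chord V r Ω = Ioo a b ∧ r + a • (Ω : R3) ∈ inflowBoundary V Ω := by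
  obtain ⟨a, b, hab, heq⟩ := exists_chord_eq_Ioo hVo hVc hVb hr Ω
  have hcl : r + a • (Ω : R3) ∈ closure V := by
    have hcont : Continuous fun s : ℝ => r + s • (Ω : R3) := by fun_prop
    have hmaps : MapsTo (fun s : ℝ => r + s • (Ω : R3)) (Ioo a b) V := fun s hs => by
      rw [← heq] at hs; exact hs
    refine hmaps.closure hcont ?_
    rw [closure_Ioo hab.ne]
    exact left_mem_Icc.2 hab.le
  have ha : r + a • (Ω : R3) ∉ V := fun h => by
    have : a ∈ chord V r Ω := h
    rw [heq] at this
    exact lt_irrefl _ this.1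
  have hmid : (a + b) / 2 ∈ chord V r Ω := by
    rw [heq]; constructor <;> linarith
  refine ⟨a, b, hab, heq, mem_inflowBoundary_of_mem_closure hVo hcl ha
    (t := (b - a) / 2) (by linarith) ?_⟩
  have e : r + a • (Ω : R3) + ((b - a) / 2) • (Ω : R3) = r + ((a + b) / 2) • (Ω : R3) := by
    module
  rw [e]
  exact hmid

end Chords

/-! ### Integration over the phase space along characteristic lines -/

section Averaging

variable {V : Set R3}

/-- The length of the chord of `V` through `r` in the direction `Ω`. -/
noncomputable def chordLength (V : Set R3) (r : R3) (Ω : S2) : ℝ≥0∞ := volume (chord V r Ω)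

theorem measurableSet_chord (hV : IsOpen V) (r : R3) (Ω : S2) : MeasurableSet (chord V r Ω) :=
  (isOpen_chord hV r Ω).measurableSet

theorem chord_add_smul (r : R3) (Ω : S2) (s : ℝ) :
    chord V (r + s • (Ω : R3)) Ω = (fun t => s + t) ⁻¹' chord V r Ω := by
  ext t
  simp only [chord, mem_ofPred_eq, mem_preimage, add_smul, add_assoc]

theorem chordLength_add_smul (r : R3) (Ω : S2) (s : ℝ) :
    chordLength V (r + s • (Ω : R3)) Ω = chordLength V r Ω := by
  rw [chordLength, chord_add_smul, measure_preimage_add, chordLength]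

theorem chordLength_ne_zero (hV : IsOpen V) {r : R3} (hr : r ∈ V) (Ω : S2) :
    chordLength V r Ω ≠ 0 :=
  ((isOpen_chord hV r Ω).measure_pos volume ⟨0, by simpa [chord] using hr⟩).ne'

theorem chordLength_ne_top (hV : Bornology.IsBounded V) (r : R3) (Ω : S2) :
    chordLength V r Ω ≠ ⊤ :=
  (isBounded_chord hV r Ω).measure_lt_top.ne

theorem measurableSet_chord_graph (hV : IsOpen V) :
    MeasurableSet {p : (R3 × S2) × ℝ | p.1.1 + p.2 • (p.1.2 : R3) ∈ V} :=
  (hV.preimage (f := fun p : (R3 × S2) × ℝ => p.1.1 + p.2 • (p.1.2 : R3))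
    (by fun_prop)).measurableSet

/-- The domain of integration varies with the parameters; writing it as an indicator on the product
with `ℝ` reduces the claim to measurability of partial integrals. -/
theorem measurable_setLIntegral_chord (hV : IsOpen V) {F : R3 × S2 → ℝ≥0∞} (hF : Measurable F) :
    Measurable fun p : R3 × S2 =>
      ∫⁻ s in chord V p.1 p.2, F (p.1 + s • (p.2 : R3), p.2) := by
  have h : Measurable fun p : (R3 × S2) × ℝ =>
      {p : (R3 × S2) × ℝ | p.1.1 + p.2 • (p.1.2 : R3) ∈ V}.indicator
        (fun p => F (p.1.1 + p.2 • (p.1.2 : R3), p.1.2)) p :=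
    (hF.comp (by fun_prop : Measurable fun p : (R3 × S2) × ℝ =>
      (p.1.1 + p.2 • (p.1.2 : R3), p.1.2))).indicator (measurableSet_chord_graph hV)
  convert! h.lintegral_prod_right' (ν := volume) using 2 with p
  rw [← lintegral_indicator (measurableSet_chord hV p.1 p.2)]
  rfl

theorem measurable_chordLength (hV : IsOpen V) :
    Measurable fun p : R3 × S2 => chordLength V p.1 p.2 := by
  simpa [chordLength] using measurable_setLIntegral_chord hV (measurable_const (a := (1 : ℝ≥0∞)))

theorem measurable_average_chord (hV : IsOpen V) {F : R3 × S2 → ℝ≥0∞} (hF : Measurable F) :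
    Measurable fun p : R3 × S2 => (chordLength V p.1 p.2)⁻¹ *
      ∫⁻ s in chord V p.1 p.2, F (p.1 + s • (p.2 : R3), p.2) :=
  (measurable_chordLength hV).inv.mul (measurable_setLIntegral_chord hV hF)

/-- Integration over `V` amounts to averaging the integrals over the chords in a fixed
direction. -/
theorem setLIntegral_eq_average_chord (hVo : IsOpen V) (hVb : Bornology.IsBounded V) (Ω : S2)
    {F : R3 → ℝ≥0∞} (hF : Measurable F) :
    ∫⁻ r in V, F r = ∫⁻ r in V, (chordLength V r Ω)⁻¹ *
      ∫⁻ s in chord V r Ω, F (r + s • (Ω : R3)) := by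
  have hVm := hVo.measurableSet
  have hline : Measurable fun p : R3 × ℝ => p.1 + p.2 • (Ω : R3) := by fun_prop
  have hline' : Measurable fun p : R3 × ℝ => p.1 - p.2 • (Ω : R3) := by fun_prop
  have hℓ : Measurable fun r : R3 => chordLength V r Ω :=
    (measurable_chordLength hVo).comp (measurable_id.prodMk measurable_const)
  set χ : R3 → ℝ≥0∞ := V.indicator 1 with hχ
  have hχm : Measurable χ := measurable_one.indicator hVm
  have hχmem : ∀ r ∈ V, χ r = 1 := fun r hr => by simp [hχ, hr]
  have hset : ∀ H : R3 → ℝ≥0∞, ∫⁻ r in V, H r = ∫⁻ r, χ r * H r := fun H => by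
    rw [← lintegral_indicator hVm]
    refine lintegral_congr fun r => ?_
    by_cases h : r ∈ V <;> simp [hχ, h]
  have hchord : ∀ (H : ℝ → ℝ≥0∞) (r : R3),
      ∫⁻ s in chord V r Ω, H s = ∫⁻ s, χ (r + s • (Ω : R3)) * H s := fun H r => by
    rw [← lintegral_indicator (measurableSet_chord hVo r Ω)]
    refine lintegral_congr fun s => ?_
    by_cases h : r + s • (Ω : R3) ∈ V
    · rw [indicator_of_mem (show s ∈ chord V r Ω from h), hχmem _ h, one_mul]
    · rw [indicator_of_notMem (show s ∉ chord V r Ω from h)]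
      simp [hχ, h]
  -- The set of `s` that translate some point of `V` to `r` is the reflected chord; its length
  -- cancels the normalising factor at the end.
  have hback : ∀ r, ∫⁻ s : ℝ, χ (r - s • (Ω : R3)) = chordLength V r Ω := fun r => by
    have h1 : ∫⁻ s in chord V r Ω, (1 : ℝ≥0∞) = chordLength V r Ω := by simp [chordLength]
    rw [← h1, hchord, ← lintegral_neg_eq_self]
    simp [sub_eq_add_neg]
  symm
  -- Chord length is constant along a line, so it can be evaluated at the moving point. Fubini, the
  -- translation `r ↦ r - sΩ` for fixed `s`, and Fubini again then isolate the inner integral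
  -- `hback`.
  calc ∫⁻ r in V, (chordLength V r Ω)⁻¹ * ∫⁻ s in chord V r Ω, F (r + s • (Ω : R3))
      = ∫⁻ r, ∫⁻ s : ℝ, χ r * ((chordLength V (r + s • (Ω : R3)) Ω)⁻¹ *
          (χ (r + s • (Ω : R3)) * F (r + s • (Ω : R3)))) := by
        rw [hset]
        refine lintegral_congr fun r => ?_
        simp only [chordLength_add_smul]
        rw [hchord, ← lintegral_const_mul, ← lintegral_const_mul] <;> fun_prop
    _ = ∫⁻ s : ℝ, ∫⁻ r, χ r * ((chordLength V (r + s • (Ω : R3)) Ω)⁻¹ *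
          (χ (r + s • (Ω : R3)) * F (r + s • (Ω : R3)))) := by
        refine lintegral_lintegral_swap (Measurable.aemeasurable ?_)
        exact (hχm.comp measurable_fst).mul (((hℓ.comp hline).inv).mul
          ((hχm.comp hline).mul (hF.comp hline)))
    _ = ∫⁻ s : ℝ, ∫⁻ r, χ (r - s • (Ω : R3)) * ((chordLength V r Ω)⁻¹ * (χ r * F r)) := by
        refine lintegral_congr fun s => ?_
        rw [← lintegral_add_right_eq_self (fun r => χ (r - s • (Ω : R3)) * _) (s • (Ω : R3))]
        simp only [add_sub_cancel_right]
    _ = ∫⁻ r, ∫⁻ s : ℝ, χ (r - s • (Ω : R3)) * ((chordLength V r Ω)⁻¹ * (χ r * F r)) := by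
        refine (lintegral_lintegral_swap (Measurable.aemeasurable ?_)).symm
        exact (hχm.comp hline').mul ((hℓ.comp measurable_fst).inv.mul
          ((hχm.comp measurable_fst).mul (hF.comp measurable_fst)))
    _ = ∫⁻ r, χ r * F r := by
        refine lintegral_congr fun r => ?_
        rw [lintegral_mul_const _ (by fun_prop), hback]
        by_cases h : r ∈ V
        · rw [← mul_assoc, ENNReal.mul_inv_cancel (chordLength_ne_zero hVo h Ω)
            (chordLength_ne_top hVb r Ω), one_mul]
        · simp [hχ, h]
    _ = ∫⁻ r in V, F r := (hset F).symm

instance : IsFiniteMeasure surfaceMeasure := by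
  unfold surfaceMeasure; infer_instance

theorem lintegral_phaseMeasure_eq_average_chord (hVo : IsOpen V) (hVb : Bornology.IsBounded V)
    {F : R3 × S2 → ℝ≥0∞} (hF : Measurable F) :
    ∫⁻ p, F p ∂phaseMeasure V = ∫⁻ p, ((chordLength V p.1 p.2)⁻¹ *
      ∫⁻ s in chord V p.1 p.2, F (p.1 + s • (p.2 : R3), p.2)) ∂phaseMeasure V := by
  rw [phaseMeasure, lintegral_prod_symm' _ hF, lintegral_prod_symm' _
    (measurable_average_chord hVo hF)]
  exact lintegral_congr fun Ω => setLIntegral_eq_average_chord hVo hVb Ω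
    (hF.comp (measurable_id.prodMk measurable_const))

theorem ae_mem_phaseMeasure (hVo : IsOpen V) : ∀ᵐ p ∂phaseMeasure V, p.1 ∈ V :=
  Measure.quasiMeasurePreserving_fst.ae (ae_restrict_mem hVo.measurableSet)

theorem ae_phaseMeasure_of_ae {P : R3 → Prop} (h : ∀ᵐ r ∂volume.restrict V, P r) :
    ∀ᵐ p ∂phaseMeasure V, P p.1 :=
  Measure.quasiMeasurePreserving_fst.ae h

/-- A property that holds almost everywhere holds almost everywhere on almost every chord. -/
theorem ae_ae_chord (hVo : IsOpen V) (hVb : Bornology.IsBounded V) {P : R3 × S2 → Prop}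
    (hP : ∀ᵐ p ∂phaseMeasure V, P p) :
    ∀ᵐ p ∂phaseMeasure V, ∀ᵐ s : ℝ, s ∈ chord V p.1 p.2 → P (p.1 + s • (p.2 : R3), p.2) := by
  obtain ⟨N, hN, hNm, hN0⟩ := exists_measurable_superset_of_null hP
  have hm : Measurable (N.indicator (1 : R3 × S2 → ℝ≥0∞)) := measurable_one.indicator hNm
  have h := lintegral_phaseMeasure_eq_average_chord hVo hVb hm
  rw [lintegral_indicator_one hNm, hN0, eq_comm, lintegral_eq_zero_iff
    (measurable_average_chord hVo hm)] at h
  filter_upwards [h] with p hp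
  have h0 : ∫⁻ s in chord V p.1 p.2, N.indicator 1 (p.1 + s • (p.2 : R3), p.2) = 0 := by
    -- The average vanishes and the chord has finite length, so the chord integral itself vanishes.
    rcases mul_eq_zero.1 hp with h1 | h1
    · exact absurd (ENNReal.inv_eq_zero.1 h1) (chordLength_ne_top hVb _ _)
    · exact h1
  have hmc : Measurable fun s : ℝ =>
      N.indicator (1 : R3 × S2 → ℝ≥0∞) (p.1 + s • (p.2 : R3), p.2) :=
    hm.comp (by fun_prop)
  rw [lintegral_eq_zero_iff hmc, Filter.EventuallyEq,
    ae_restrict_iff' (measurableSet_chord hVo _ _)] at h0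
  filter_upwards [h0] with s hs hmem
  by_contra hcon
  have : (p.1 + s • (p.2 : R3), p.2) ∈ N := hN hcon
  have := hs hmem
  simp_all

theorem ae_setLIntegral_chord_lt_top (hVo : IsOpen V) (hVb : Bornology.IsBounded V)
    {F : R3 × S2 → ℝ≥0∞} (hF : Measurable F) (hfin : ∫⁻ p, F p ∂phaseMeasure V ≠ ⊤) :
    ∀ᵐ p ∂phaseMeasure V, ∫⁻ s in chord V p.1 p.2, F (p.1 + s • (p.2 : R3), p.2) < ⊤ := by
  rw [lintegral_phaseMeasure_eq_average_chord hVo hVb hF] at hfin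
  filter_upwards [ae_lt_top (measurable_average_chord hVo hF) hfin] with p hp
  by_contra! hcon
  rw [top_le_iff.1 hcon, ENNReal.mul_top
    (ENNReal.inv_ne_zero.2 (chordLength_ne_top hVb _ _))] at hp
  exact lt_irrefl _ hp

/-- Inequalities between integrals over almost every chord can be integrated. -/
theorem lintegral_phaseMeasure_mono_of_chord (hVo : IsOpen V) (hVb : Bornology.IsBounded V)
    {F G : R3 × S2 → ℝ≥0∞} (hF : AEMeasurable F (phaseMeasure V))
    (hG : AEMeasurable G (phaseMeasure V))
    (h : ∀ᵐ p ∂phaseMeasure V, ∫⁻ s in chord V p.1 p.2, F (p.1 + s • (p.2 : R3), p.2) ≤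
      ∫⁻ s in chord V p.1 p.2, G (p.1 + s • (p.2 : R3), p.2)) :
    ∫⁻ p, F p ∂phaseMeasure V ≤ ∫⁻ p, G p ∂phaseMeasure V := by
  -- The averaging formula needs measurable integrands. Passing to representatives is harmless,
  -- because almost every chord meets the exceptional null set in a null set.
  rw [lintegral_congr_ae hF.ae_eq_mk, lintegral_congr_ae hG.ae_eq_mk,
    lintegral_phaseMeasure_eq_average_chord hVo hVb hF.measurable_mk,
    lintegral_phaseMeasure_eq_average_chord hVo hVb hG.measurable_mk]
  refine lintegral_mono_ae ?_
  filter_upwards [h, ae_ae_chord hVo hVb hF.ae_eq_mk, ae_ae_chord hVo hVb hG.ae_eq_mk]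
    with p hp hFp hGp
  have hm := measurableSet_chord hVo p.1 p.2
  rw [← setLIntegral_congr_fun_ae hm hFp, ← setLIntegral_congr_fun_ae hm hGp]
  gcongr

end Averaging

/-! ### The weighted energy estimate -/

section Energy

theorem eLpNorm_two_sq {α : Type*} [MeasurableSpace α] (μ : Measure α) (f : α → ℝ) :
    eLpNorm f 2 μ ^ 2 = ∫⁻ x, ‖f x‖ₑ ^ 2 ∂μ := by
  rw [eLpNorm_eq_lintegral_rpow_enorm_toReal two_ne_zero ENNReal.ofNat_ne_top,
    ← ENNReal.rpow_natCast, ← ENNReal.rpow_mul]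
  simp

theorem eLpNorm_two_le_iff {α β : Type*} [MeasurableSpace α] [MeasurableSpace β]
    {μ : Measure α} {ν : Measure β} {f : α → ℝ} {g : β → ℝ} :
    eLpNorm f 2 μ ≤ eLpNorm g 2 ν ↔ ∫⁻ x, ‖f x‖ₑ ^ 2 ∂μ ≤ ∫⁻ x, ‖g x‖ₑ ^ 2 ∂ν := by
  rw [← eLpNorm_two_sq, ← eLpNorm_two_sq, ENNReal.pow_le_pow_left_iff two_ne_zero]

theorem enorm_sqrt_mul_sq {s : ℝ} (hs : 0 ≤ s) (x : ℝ) :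
    ‖Real.sqrt s * x‖ₑ ^ 2 = ENNReal.ofReal (s * x ^ 2) := by
  rw [← enorm_pow, mul_pow, Real.sq_sqrt hs, Real.enorm_of_nonneg (by positivity)]

theorem enorm_div_sqrt_sq {s : ℝ} (hs : 0 ≤ s) (x : ℝ) :
    ‖x / Real.sqrt s‖ₑ ^ 2 = ENNReal.ofReal (x ^ 2 / s) := by
  rw [← enorm_pow, div_pow, Real.sq_sqrt hs, Real.enorm_of_nonneg (by positivity)]

/-- The line lemmas need a coefficient that is measurable and bounded on the entire line, also
outside `V`. The upper bound is `max m M` because `M < m` is possible when `V` is empty. -/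
theorem exists_measurable_clamp {V : Set R3} (hVo : IsOpen V) {σ : R3 → ℝ} {m M : ℝ}
    (hσ : AEMeasurable σ (volume.restrict V)) (hσb : ∀ r ∈ V, m ≤ σ r ∧ σ r ≤ M) :
    ∃ S : R3 → ℝ, Measurable S ∧ (∀ r, m ≤ S r) ∧ (∀ r, S r ≤ max m M) ∧
      σ =ᵐ[volume.restrict V] S := by
  refine ⟨fun r => max m (min M (hσ.mk σ r)),
    measurable_const.max (measurable_const.min hσ.measurable_mk), fun r => le_max_left _ _,
    fun r => max_le_max le_rfl (min_le_left _ _), ?_⟩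
  filter_upwards [hσ.ae_eq_mk, ae_restrict_mem hVo.measurableSet] with r hr hrV
  rw [← hr, min_eq_right (hσb r hrV).2, max_eq_right (hσb r hrV).1]

theorem lineDeriv_eq_deriv_line (ψ : R3 → S2 → ℝ) (r : R3) (Ω : S2) (s : ℝ) :
    lineDeriv ℝ (fun y => ψ y Ω) (r + s • (Ω : R3)) (Ω : R3) =
      deriv (fun t : ℝ => ψ (r + t • (Ω : R3)) Ω) s := by
  have := deriv_comp_const_add (f := fun t : ℝ => ψ (r + t • (Ω : R3)) Ω) s 0
  rw [add_zero] at this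
  rw [← this, lineDeriv]
  simp only [add_smul, add_assoc]

variable {V : Set R3} {σ q : R3 → ℝ} {ψ : R3 → S2 → ℝ} {m M : ℝ}

theorem SolvesAlong.absolutelyContinuous_of_chord {r : R3} {Ω : S2} {a b : ℝ}
    (h : SolvesAlong V σ q ψ r Ω) (hab : chord V r Ω = Ioo a b)
    (ha : r + a • (Ω : R3) ∈ inflowBoundary V Ω) :
    ∀ c ∈ Ioo a b,
      AbsolutelyContinuousOnInterval (fun s : ℝ => ψ (r + s • (Ω : R3)) Ω) a c := by
  intro c hc
  refine h.absolutelyContinuous a c hc.1.le fun s hs => ?_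
  rcases hs.1.eq_or_lt with rfl | hlt
  · exact Or.inr ha
  · left
    have : s ∈ chord V r Ω := by rw [hab]; exact ⟨hlt, hs.2.trans_lt hc.2⟩
    exact this

theorem aemeasurable_phase_fst {f : R3 → ℝ} (hf : AEMeasurable f (volume.restrict V)) :
    AEMeasurable (fun p : R3 × S2 => f p.1) (phaseMeasure V) :=
  hf.comp_quasiMeasurePreserving Measure.quasiMeasurePreserving_fst

/-- The line estimate on almost every chord, integrated over phase space. Only measurability of `ψ`
is assumed, so the estimate can also serve to prove that a candidate solution is square integrable.
-/
theorem eLpNorm_sqrt_mul_le_of_solvesAlong (hVo : IsOpen V) (hVc : Convex ℝ V)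
    (hVb : Bornology.IsBounded V) (hσ : AEMeasurable σ (volume.restrict V)) (hm : 0 < m)
    (hσb : ∀ r ∈ V, m ≤ σ r ∧ σ r ≤ M) (hq : AEMeasurable q (volume.restrict V))
    (hψ : AEStronglyMeasurable (Function.uncurry ψ) (phaseMeasure V))
    (hsol : ∀ᵐ p ∂(phaseMeasure V), SolvesAlong V σ q ψ p.1 p.2) :
    eLpNorm (fun p : R3 × S2 => Real.sqrt (σ p.1) * ψ p.1 p.2) 2 (phaseMeasure V) ≤
      eLpNorm (fun p : R3 × S2 => q p.1 / Real.sqrt (σ p.1)) 2 (phaseMeasure V) := by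
  obtain ⟨S, hS, hSm, hSM, hSσ⟩ := exists_measurable_clamp hVo hσ hσb
  rw [eLpNorm_two_le_iff]
  have hσ' := aemeasurable_phase_fst hσ
  have hq' := aemeasurable_phase_fst hq
  refine lintegral_phaseMeasure_mono_of_chord hVo hVb
    ((hσ'.sqrt.mul hψ.aemeasurable).enorm.pow_const 2) ((hq'.div hσ'.sqrt).enorm.pow_const 2) ?_
  filter_upwards [hsol, ae_mem_phaseMeasure hVo,
    ae_ae_chord hVo hVb (ae_phaseMeasure_of_ae hSσ),
    ae_ae_chord hVo hVb (ae_phaseMeasure_of_ae hq.ae_eq_mk)] with p hp hpV hpS hpq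
  obtain ⟨r, Ω⟩ := p
  obtain ⟨a, b, hab, hchord, hin⟩ := exists_chord_eq_Ioo_inflow hVo hVc hVb hpV Ω
  have hline : Measurable fun s : ℝ => r + s • (Ω : R3) := by fun_prop
  have key := energy_estimate_Ioo hab hm (hS.comp hline) (fun s => hSm _) (fun s => hSM _)
    (hq.measurable_mk.comp hline) (hp.absolutelyContinuous_of_chord hchord hin)
    (hp.vacuum a hin) (by
      filter_upwards [hp.equation, hpS, hpq] with s h1 h2 h3 hs
      rw [← hchord] at hs
      have h4 := h1 hs
      rw [transportOp, lineDeriv_eq_deriv_line, h2 hs, h3 hs] at h4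
      exact h4)
  rw [← hchord] at key
  have hcm := measurableSet_chord hVo r Ω
  refine (le_of_eq (setLIntegral_congr_fun_ae hcm ?_)).trans
    (key.trans (le_of_eq (setLIntegral_congr_fun_ae hcm ?_)))
  · filter_upwards [hpS] with s h2 hs
    rw [h2 hs, enorm_sqrt_mul_sq (hm.le.trans (hSm _))]
    rfl
  · filter_upwards [hpS, hpq] with s h2 h3 hs
    rw [h2 hs, h3 hs, enorm_div_sqrt_sq (hm.le.trans (hSm _))]
    rfl

/-! ### The scalar flux -/

theorem surfaceMeasure_univ : surfaceMeasure univ = ENNReal.ofReal (4 * Real.pi) := by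
  rw [surfaceMeasure, Measure.toSphere_apply_univ, EuclideanSpace.volume_ball_fin_three]
  simp only [finrank_euclideanSpace, Fintype.card_fin]
  rw [← ENNReal.ofReal_natCast, ← ENNReal.ofReal_pow zero_le_one,
    ← ENNReal.ofReal_mul (by positivity), ← ENNReal.ofReal_mul (by positivity)]
  congr 1
  push_cast
  ring

theorem surfaceMeasure_univ_ne_zero : surfaceMeasure univ ≠ 0 := by
  rw [surfaceMeasure_univ]; simpa using Real.pi_pos

/-- The average over the sphere is bounded by the mean square. -/
theorem enorm_scalarFlux_sq_le {r : R3} (hψ : AEStronglyMeasurable (ψ r) surfaceMeasure) :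
    ‖scalarFlux ψ r‖ₑ ^ 2 ≤
      (surfaceMeasure univ)⁻¹ * ∫⁻ Ω, ‖ψ r Ω‖ₑ ^ 2 ∂surfaceMeasure := by
  have hpi : 0 < 4 * Real.pi := by positivity
  have h0 := surfaceMeasure_univ_ne_zero
  have htop : surfaceMeasure univ ≠ ⊤ := measure_ne_top _ _
  have h1 : ‖∫ Ω, ψ r Ω ∂surfaceMeasure‖ₑ ≤
      eLpNorm (ψ r) 2 surfaceMeasure * surfaceMeasure univ ^ (1 / 2 : ℝ) := by
    refine (enorm_integral_le_lintegral_enorm _).trans ?_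
    rw [← eLpNorm_one_eq_lintegral_enorm]
    refine (eLpNorm_le_eLpNorm_mul_rpow_measure_univ one_le_two hψ).trans (le_of_eq ?_)
    norm_num
  have h2 : ‖∫ Ω, ψ r Ω ∂surfaceMeasure‖ₑ ^ 2 ≤
      (∫⁻ Ω, ‖ψ r Ω‖ₑ ^ 2 ∂surfaceMeasure) * surfaceMeasure univ := by
    refine (pow_le_pow_left' h1 2).trans (le_of_eq ?_)
    rw [mul_pow, eLpNorm_two_sq, ← ENNReal.rpow_natCast (_ ^ (1 / 2 : ℝ)), ← ENNReal.rpow_mul]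
    norm_num
  have h3 : ‖1 / (4 * Real.pi)‖ₑ = (surfaceMeasure univ)⁻¹ := by
    rw [surfaceMeasure_univ, Real.enorm_of_nonneg (by positivity), one_div,
      ENNReal.ofReal_inv_of_pos hpi]
  rw [scalarFlux, enorm_mul, mul_pow, h3]
  calc (surfaceMeasure univ)⁻¹ ^ 2 * ‖∫ Ω, ψ r Ω ∂surfaceMeasure‖ₑ ^ 2
      ≤ (surfaceMeasure univ)⁻¹ ^ 2 *
        ((∫⁻ Ω, ‖ψ r Ω‖ₑ ^ 2 ∂surfaceMeasure) * surfaceMeasure univ) := by gcongr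
    _ = ((surfaceMeasure univ)⁻¹ * surfaceMeasure univ) *
        ((surfaceMeasure univ)⁻¹ * ∫⁻ Ω, ‖ψ r Ω‖ₑ ^ 2 ∂surfaceMeasure) := by ring
    _ = _ := by rw [ENNReal.inv_mul_cancel h0 htop, one_mul]

theorem aestronglyMeasurable_scalarFlux
    (hψ : AEStronglyMeasurable (Function.uncurry ψ) (phaseMeasure V)) :
    AEStronglyMeasurable (scalarFlux ψ) (volume.restrict V) :=
  hψ.integral_prod_right'.const_mul _

theorem lintegral_phaseMeasure_fst {F : R3 → ℝ≥0∞} (hF : AEMeasurable F (volume.restrict V)) :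
    ∫⁻ p, F p.1 ∂phaseMeasure V = surfaceMeasure univ * ∫⁻ r in V, F r := by
  have hF' : AEMeasurable (fun p : R3 × S2 => F p.1) ((volume.restrict V).prod surfaceMeasure) :=
    hF.comp_quasiMeasurePreserving Measure.quasiMeasurePreserving_fst
  rw [phaseMeasure, lintegral_prod _ hF']
  simp only [lintegral_const]
  rw [lintegral_mul_const' _ _ (measure_ne_top _ _), mul_comm]

/-- The scalar flux of a solution is bounded in the norm of `L²(V, σ dr)`. -/
theorem eLpNorm_sqrt_mul_scalarFlux_le (hVo : IsOpen V) (hVc : Convex ℝ V)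
    (hVb : Bornology.IsBounded V) (hσ : AEMeasurable σ (volume.restrict V)) (hm : 0 < m)
    (hσb : ∀ r ∈ V, m ≤ σ r ∧ σ r ≤ M) (hq : AEMeasurable q (volume.restrict V))
    (hsol : IsTransportSolution V σ q ψ) :
    eLpNorm (fun r => Real.sqrt (σ r) * scalarFlux ψ r) 2 (volume.restrict V) ≤
      eLpNorm (fun r => q r / Real.sqrt (σ r)) 2 (volume.restrict V) := by
  have hψ := hsol.memLp.aestronglyMeasurable
  have h0 := surfaceMeasure_univ_ne_zero
  have htop : surfaceMeasure univ ≠ ⊤ := measure_ne_top _ _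
  have key := eLpNorm_sqrt_mul_le_of_solvesAlong hVo hVc hVb hσ hm hσb hq hψ hsol.solvesAlong
  have hF : AEMeasurable (fun p : R3 × S2 => ‖Real.sqrt (σ p.1) * ψ p.1 p.2‖ₑ ^ 2)
      ((volume.restrict V).prod surfaceMeasure) :=
    ((aemeasurable_phase_fst hσ).sqrt.mul hψ.aemeasurable).enorm.pow_const 2
  rw [eLpNorm_two_le_iff] at key ⊢
  rw [lintegral_phaseMeasure_fst (F := fun r => ‖q r / Real.sqrt (σ r)‖ₑ ^ 2)
    ((hq.div hσ.sqrt).enorm.pow_const 2), phaseMeasure, lintegral_prod _ hF] at key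
  -- The weight does not depend on direction, so the mean square bound holds with it inserted. The
  -- total mass of the sphere produced by the isotropic source then cancels the normalisation.
  have hflux : ∫⁻ r in V, ‖Real.sqrt (σ r) * scalarFlux ψ r‖ₑ ^ 2 ≤
      ∫⁻ r in V, (surfaceMeasure univ)⁻¹ *
        ∫⁻ Ω, ‖Real.sqrt (σ r) * ψ r Ω‖ₑ ^ 2 ∂surfaceMeasure := by
    refine lintegral_mono_ae ?_
    filter_upwards [hψ.prodMk_left] with r hr
    simp only [enorm_mul, mul_pow]
    rw [lintegral_const_mul' _ _ (by simp), mul_left_comm]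
    gcongr
    exact enorm_scalarFlux_sq_le hr
  refine hflux.trans ?_
  rw [lintegral_const_mul' _ _ (ENNReal.inv_ne_top.2 h0)]
  calc _ ≤ (surfaceMeasure univ)⁻¹ *
        (surfaceMeasure univ * ∫⁻ r in V, ‖q r / Real.sqrt (σ r)‖ₑ ^ 2) := by gcongr
    _ = _ := by rw [← mul_assoc, ENNReal.inv_mul_cancel h0 htop, one_mul]

end Energy

/-! ### Solutions of the pure transport problem -/

section PureTransport

variable {V : Set R3} {σ q q' : R3 → ℝ} {ψ ψ' : R3 → S2 → ℝ} {m M : ℝ}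

theorem IsTransportSolution.congr_source (hVo : IsOpen V) (hVb : Bornology.IsBounded V)
    (h : IsTransportSolution V σ q ψ) (hq : q =ᵐ[volume.restrict V] q') :
    IsTransportSolution V σ q' ψ := by
  refine ⟨h.memLp, ?_⟩
  filter_upwards [h.solvesAlong, ae_ae_chord hVo hVb (ae_phaseMeasure_of_ae hq)] with p hp hpq
  refine ⟨hp.absolutelyContinuous, ?_, hp.vacuum⟩
  filter_upwards [hp.equation, hpq] with s h1 h2 hs
  rw [h1 hs, h2 hs]

theorem SolvesAlong.ae_differentiableAt (hVo : IsOpen V) (hVc : Convex ℝ V)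
    (hVb : Bornology.IsBounded V) {r : R3} {Ω : S2} (hr : r ∈ V)
    (h : SolvesAlong V σ q ψ r Ω) :
    ∀ᵐ s : ℝ, s ∈ chord V r Ω →
      DifferentiableAt ℝ (fun t : ℝ => ψ (r + t • (Ω : R3)) Ω) s := by
  obtain ⟨a, b, hab, hchord, hin⟩ := exists_chord_eq_Ioo_inflow hVo hVc hVb hr Ω
  have hac := h.absolutelyContinuous_of_chord hchord hin
  -- Absolute continuity is available only on `[a, c]` with `c < b`; rational `c` exhaust the chord
  -- with countably many exceptional sets.
  have hall : ∀ᵐ s : ℝ, ∀ c : ℚ, (c : ℝ) ∈ Ioo a b → s ∈ uIcc a (c : ℝ) →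
      DifferentiableAt ℝ (fun t : ℝ => ψ (r + t • (Ω : R3)) Ω) s := by
    rw [ae_all_iff]
    intro c
    by_cases hc : (c : ℝ) ∈ Ioo a b
    · filter_upwards [(hac c hc).ae_differentiableAt] with s hs _ using hs
    · exact Filter.Eventually.of_forall fun s hc' => absurd hc' hc
  filter_upwards [hall] with s hs hmem
  rw [hchord] at hmem
  obtain ⟨c, hc1, hc2⟩ := exists_rat_btwn hmem.2
  refine hs c ⟨hmem.1.trans hc1, hc2⟩ ?_
  rw [uIcc_of_le (hmem.1.trans hc1).le]
  exact ⟨hmem.1.le, hc1.le⟩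

/-- `lineDeriv` is additive only where both functions are differentiable along the line; absolute
continuity provides this at almost every point of the chord. -/
theorem IsTransportSolution.sub (hVo : IsOpen V) (hVc : Convex ℝ V)
    (hVb : Bornology.IsBounded V) (h : IsTransportSolution V σ q ψ)
    (h' : IsTransportSolution V σ q' ψ') :
    IsTransportSolution V σ (fun r => q r - q' r) (fun r Ω => ψ r Ω - ψ' r Ω) := by
  refine ⟨h.memLp.sub h'.memLp, ?_⟩
  filter_upwards [h.solvesAlong, h'.solvesAlong, ae_mem_phaseMeasure hVo] with p hp hp' hpV
  refine ⟨fun a b hab hs => (hp.absolutelyContinuous a b hab hs).sub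
    (hp'.absolutelyContinuous a b hab hs), ?_, fun s hs => ?_⟩
  · filter_upwards [hp.equation, hp'.equation, hp.ae_differentiableAt hVo hVc hVb hpV,
      hp'.ae_differentiableAt hVo hVc hVb hpV] with s h1 h2 h3 h4 hs
    rw [← h1 hs, ← h2 hs]
    simp only [transportOp]
    rw [lineDeriv_eq_deriv_line ψ, lineDeriv_eq_deriv_line ψ',
      lineDeriv_eq_deriv_line (fun r Ω => ψ r Ω - ψ' r Ω), deriv_fun_sub (h3 hs) (h4 hs)]
    ring
  · rw [hp.vacuum s hs, hp'.vacuum s hs, sub_zero]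

theorem IsTransportSolution.ae_eq_zero (hVo : IsOpen V) (hVc : Convex ℝ V)
    (hVb : Bornology.IsBounded V) (hσ : AEMeasurable σ (volume.restrict V)) (hm : 0 < m)
    (hσb : ∀ r ∈ V, m ≤ σ r ∧ σ r ≤ M) (h : IsTransportSolution V σ q ψ)
    (hq : q =ᵐ[volume.restrict V] 0) : Function.uncurry ψ =ᵐ[phaseMeasure V] 0 := by
  have h0 := h.congr_source hVo hVb hq
  have hψ := h.memLp.aestronglyMeasurable
  have key := eLpNorm_sqrt_mul_le_of_solvesAlong hVo hVc hVb hσ hm hσb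
    aemeasurable_const hψ h0.solvesAlong
  have hz : eLpNorm (fun p : R3 × S2 => (0 : R3 → ℝ) p.1 / Real.sqrt (σ p.1)) 2
      (phaseMeasure V) = 0 := by simp
  replace key := nonpos_iff_eq_zero.1 (key.trans_eq hz)
  have hF : AEStronglyMeasurable (fun p : R3 × S2 => Real.sqrt (σ p.1) * ψ p.1 p.2)
      (phaseMeasure V) :=
    ((aemeasurable_phase_fst hσ).sqrt.mul hψ.aemeasurable).aestronglyMeasurable
  rw [eLpNorm_eq_zero_iff hF two_ne_zero] at key
  filter_upwards [key, ae_mem_phaseMeasure hVo] with p hp hpV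
  exact (mul_eq_zero.1 hp).resolve_left
    (Real.sqrt_pos.2 (hm.trans_le (hσb _ hpV).1)).ne'

theorem IsTransportSolution.ae_unique (hVo : IsOpen V) (hVc : Convex ℝ V)
    (hVb : Bornology.IsBounded V) (hσ : AEMeasurable σ (volume.restrict V)) (hm : 0 < m)
    (hσb : ∀ r ∈ V, m ≤ σ r ∧ σ r ≤ M) (h : IsTransportSolution V σ q ψ)
    (h' : IsTransportSolution V σ q' ψ') (hq : q =ᵐ[volume.restrict V] q') :
    Function.uncurry ψ =ᵐ[phaseMeasure V] Function.uncurry ψ' := by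
  have hsub := (h.sub hVo hVc hVb h').ae_eq_zero hVo hVc hVb hσ hm hσb (by
    filter_upwards [hq] with r hr
    simp [hr])
  filter_upwards [hsub] with p hp
  exact sub_eq_zero.1 hp

/-- The solution of the pure transport problem, obtained by integration along the characteristic
lines. -/
noncomputable def transportSolution (S g : R3 → ℝ) (r : R3) (Ω : S2) : ℝ :=
  attenuated (fun s => S (r + s • (Ω : R3))) (fun s => g (r + s • (Ω : R3))) 0

theorem transportSolution_line (S g : R3 → ℝ) (r : R3) (Ω : S2) (s : ℝ) :
    transportSolution S g (r + s • (Ω : R3)) Ω =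
      attenuated (fun s => S (r + s • (Ω : R3))) (fun s => g (r + s • (Ω : R3))) s := by
  have e : ∀ u : ℝ, r + s • (Ω : R3) + (0 - u) • (Ω : R3) = r + (s - u) • (Ω : R3) := fun u => by
    module
  simp only [transportSolution, attenuated, e]

theorem stronglyMeasurable_transportSolution {S g : R3 → ℝ} (hS : Measurable S)
    (hg : Measurable g) : StronglyMeasurable (Function.uncurry (transportSolution S g)) := by
  have hin : StronglyMeasurable fun p : (R3 × S2) × ℝ =>
      ∫ u in (0 : ℝ)..p.2, S (p.1.1 + (0 - u) • (p.1.2 : R3)) := by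
    -- The variable upper limit is scaled to `1`, so that the integration runs over a fixed measure.
    have h1 : StronglyMeasurable fun w : ((R3 × S2) × ℝ) × ℝ =>
        S (w.1.1.1 + (0 - w.1.2 * w.2) • (w.1.1.2 : R3)) :=
      (hS.comp (by fun_prop)).stronglyMeasurable
    have h2 := (measurable_snd (α := R3 × S2) (β := ℝ)).stronglyMeasurable.mul
      (h1.integral_prod_right' (ν := volume.restrict (Ioc 0 1)))
    convert h2 using 1
    funext p
    have h3 := intervalIntegral.smul_integral_comp_mul_left
      (f := fun u : ℝ => S (p.1.1 + (0 - u) • (p.1.2 : R3))) (a := 0) (b := 1) p.2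
    rw [mul_zero, mul_one, intervalIntegral.integral_of_le zero_le_one] at h3
    exact h3.symm
  have hout : StronglyMeasurable fun p : (R3 × S2) × ℝ =>
      Real.exp (-∫ u in (0 : ℝ)..p.2, S (p.1.1 + (0 - u) • (p.1.2 : R3))) *
        g (p.1.1 + (0 - p.2) • (p.1.2 : R3)) :=
    (Real.continuous_exp.comp_stronglyMeasurable hin.neg).mul
      (hg.comp (by fun_prop : Measurable fun p : (R3 × S2) × ℝ =>
        p.1.1 + (0 - p.2) • (p.1.2 : R3))).stronglyMeasurable
  exact hout.integral_prod_right' (ν := volume.restrict (Ioi 0))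

theorem exists_isTransportSolution (hVo : IsOpen V) (hVc : Convex ℝ V)
    (hVb : Bornology.IsBounded V) (hσ : AEMeasurable σ (volume.restrict V)) (hm : 0 < m)
    (hσb : ∀ r ∈ V, m ≤ σ r ∧ σ r ≤ M) (hq : MemLp q 2 (volume.restrict V)) :
    ∃ ψ, IsTransportSolution V σ q ψ := by
  obtain ⟨S, hS, hSm, hSM, hSσ⟩ := exists_measurable_clamp hVo hσ hσb
  have hVm := hVo.measurableSet
  have hqm := hq.aestronglyMeasurable.aemeasurable
  -- Extending the source by zero makes the explicit formula meaningful on whole lines and builds in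
  -- the vacuum condition.
  set g : R3 → ℝ := V.indicator (hqm.mk q) with hg
  have hgm : Measurable g := hqm.measurable_mk.indicator hVm
  have hgq : q =ᵐ[volume.restrict V] g := by
    filter_upwards [hqm.ae_eq_mk, ae_restrict_mem hVm] with r hr hrV
    rw [hr, hg, indicator_of_mem hrV]
  have hg0 : ∀ r ∉ V, g r = 0 := fun r hr => indicator_of_notMem hr _
  have hfin : ∫⁻ p : R3 × S2, ‖g p.1‖ₑ ^ 2 ∂phaseMeasure V ≠ ⊤ := by
    rw [lintegral_phaseMeasure_fst (F := fun r => ‖g r‖ₑ ^ 2) (by fun_prop),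
      ← eLpNorm_two_sq]
    exact ENNReal.mul_ne_top (measure_ne_top _ _)
      (ENNReal.pow_ne_top ((memLp_congr_ae hgq).1 hq).eLpNorm_ne_top)
  have hline : ∀ (r : R3) (Ω : S2), Measurable fun s : ℝ => r + s • (Ω : R3) :=
    fun r Ω => by fun_prop
  have hmeas := stronglyMeasurable_transportSolution hS hgm
  have hsol : ∀ᵐ p ∂phaseMeasure V, SolvesAlong V σ q (transportSolution S g) p.1 p.2 := by
    filter_upwards [ae_mem_phaseMeasure hVo,
      ae_setLIntegral_chord_lt_top hVo hVb (F := fun p => ‖g p.1‖ₑ ^ 2) (by fun_prop) hfin,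
      ae_ae_chord hVo hVb (ae_phaseMeasure_of_ae hSσ),
      ae_ae_chord hVo hVb (ae_phaseMeasure_of_ae hgq)] with p hpV hpfin hpS hpg
    obtain ⟨r, Ω⟩ := p
    have hSl : Measurable fun s : ℝ => S (r + s • (Ω : R3)) := hS.comp (hline r Ω)
    have hGm : Measurable fun s : ℝ => g (r + s • (Ω : R3)) := hgm.comp (hline r Ω)
    have hG : Integrable fun s : ℝ => g (r + s • (Ω : R3)) := by
      have h1 : IntegrableOn (fun s : ℝ => g (r + s • (Ω : R3))) (chord V r Ω) := by
        have : IsFiniteMeasure (volume.restrict (chord V r Ω)) :=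
          isFiniteMeasure_restrict.2 (chordLength_ne_top hVb r Ω)
        refine MemLp.integrable one_le_two ⟨hGm.aestronglyMeasurable, ?_⟩
        by_contra! hcon
        have h2 := eLpNorm_two_sq (volume.restrict (chord V r Ω))
          (fun s : ℝ => g (r + s • (Ω : R3)))
        rw [top_le_iff.1 hcon] at h2
        exact hpfin.ne (by simpa using h2.symm)
      refine (integrableOn_iff_integrable_of_support_subset fun s hs => ?_).1 h1
      by_contra hcon
      exact hs (hg0 _ hcon)
    have hS0 : ∀ s : ℝ, 0 ≤ S (r + s • (Ω : R3)) := fun s => hm.le.trans (hSm _)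
    have hSabs : ∀ s : ℝ, |S (r + s • (Ω : R3))| ≤ max m M := fun s => by
      rw [abs_of_nonneg (hS0 s)]; exact hSM _
    have hfun : (fun s : ℝ => transportSolution S g (r + s • (Ω : R3)) Ω) =
        attenuated (fun s => S (r + s • (Ω : R3))) (fun s => g (r + s • (Ω : R3))) :=
      funext fun s => transportSolution_line S g r Ω s
    refine ⟨fun a b _ _ => ?_, ?_, fun s hs => ?_⟩
    · simp only [hfun]
      exact absolutelyContinuousOnInterval_attenuated hSl hS0 hSabs hG a b
    · filter_upwards [ae_hasDerivAt_attenuated hSl hS0 hSabs hG, hpS, hpg] with s h1 h2 h3 hs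
      rw [transportOp, lineDeriv_eq_deriv_line, hfun, h1.deriv, transportSolution_line, h2 hs,
        h3 hs]
      ring
    · rw [transportSolution_line]
      refine attenuated_eq_zero fun t ht => hg0 _ ?_
      have := notMem_of_mem_inflowBoundary hVo hVc hs (sub_pos.2 ht)
      rwa [show r + s • (Ω : R3) - (s - t) • (Ω : R3) = r + t • (Ω : R3) by module] at this
  refine ⟨transportSolution S g, ⟨?_, hsol⟩⟩
  -- Square integrability of the candidate follows from the energy estimate applied to it, since `σ
  -- ≥ m` makes the weights harmless.
  have hen := eLpNorm_sqrt_mul_le_of_solvesAlong hVo hVc hVb hσ hm hσb hqm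
    hmeas.aestronglyMeasurable hsol
  have hσ' := aemeasurable_phase_fst hσ
  have hsqrt : ∀ᵐ p ∂phaseMeasure V, Real.sqrt m ≤ Real.sqrt (σ p.1) := by
    filter_upwards [ae_mem_phaseMeasure hVo] with p hp
    exact Real.sqrt_le_sqrt (hσb _ hp).1
  have hmpos := Real.sqrt_pos.2 hm
  have hqL : MemLp (fun p : R3 × S2 => q p.1) 2 (phaseMeasure V) := by
    refine ⟨(aemeasurable_phase_fst hqm).aestronglyMeasurable, ?_⟩
    by_contra! hcon
    have h2 := eLpNorm_two_sq (phaseMeasure V) (fun p : R3 × S2 => q p.1)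
    rw [top_le_iff.1 hcon, lintegral_phaseMeasure_fst (F := fun r => ‖q r‖ₑ ^ 2)
      (hqm.enorm.pow_const 2), ← eLpNorm_two_sq] at h2
    refine ENNReal.mul_ne_top (measure_ne_top _ _)
      (ENNReal.pow_ne_top hq.eLpNorm_ne_top) (h2.symm.trans (by simp))
  have hrhs : MemLp (fun p : R3 × S2 => q p.1 / Real.sqrt (σ p.1)) 2 (phaseMeasure V) := by
    refine hqL.of_le_mul (c := (Real.sqrt m)⁻¹)
      ((aemeasurable_phase_fst hqm).div hσ'.sqrt).aestronglyMeasurable ?_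
    filter_upwards [hsqrt] with p hp
    rw [norm_div, Real.norm_of_nonneg (Real.sqrt_nonneg _), div_eq_inv_mul]
    gcongr
  have hlhs : MemLp (fun p : R3 × S2 => Real.sqrt (σ p.1) * transportSolution S g p.1 p.2) 2
      (phaseMeasure V) :=
    ⟨(hσ'.sqrt.mul hmeas.measurable.aemeasurable).aestronglyMeasurable,
      hen.trans_lt hrhs.eLpNorm_lt_top⟩
  refine hlhs.of_le_mul (c := (Real.sqrt m)⁻¹) hmeas.aestronglyMeasurable ?_
  filter_upwards [hsqrt] with p hp
  rw [norm_mul, Real.norm_of_nonneg (Real.sqrt_nonneg _), ← mul_assoc]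
  refine le_mul_of_one_le_left (norm_nonneg _) ?_
  rw [← div_eq_inv_mul, one_le_div hmpos]
  exact hp

end PureTransport

/-! ### The radiative transport equation -/

section RadiativeTransport

variable {V : Set R3} {σ σS q Q : R3 → ℝ} {ψ ψ' : R3 → S2 → ℝ} {m M MS : ℝ}

theorem memLp_scalarFlux (hψ : MemLp (Function.uncurry ψ) 2 (phaseMeasure V)) :
    MemLp (scalarFlux ψ) 2 (volume.restrict V) := by
  have hm := hψ.aestronglyMeasurable
  refine ⟨aestronglyMeasurable_scalarFlux hm, ?_⟩
  have h0 := surfaceMeasure_univ_ne_zero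
  have hF : AEMeasurable (fun p : R3 × S2 => ‖ψ p.1 p.2‖ₑ ^ 2)
      ((volume.restrict V).prod surfaceMeasure) := hm.aemeasurable.enorm.pow_const 2
  have hle : eLpNorm (scalarFlux ψ) 2 (volume.restrict V) ^ 2 ≤
      (surfaceMeasure univ)⁻¹ * eLpNorm (Function.uncurry ψ) 2 (phaseMeasure V) ^ 2 := by
    rw [eLpNorm_two_sq, eLpNorm_two_sq]
    refine (lintegral_mono_ae (hm.prodMk_left.mono fun r hr => enorm_scalarFlux_sq_le hr)).trans ?_
    rw [lintegral_const_mul' _ _ (ENNReal.inv_ne_top.2 h0), phaseMeasure]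
    exact mul_le_mul_right (lintegral_prod _ hF).ge _
  by_contra! hcon
  rw [top_le_iff.1 hcon] at hle
  exact ENNReal.mul_ne_top (ENNReal.inv_ne_top.2 h0) (ENNReal.pow_ne_top hψ.eLpNorm_ne_top)
    (top_le_iff.1 (by simpa using hle))

theorem ae_scalarFlux_sub (hVb : Bornology.IsBounded V)
    (hψ : MemLp (Function.uncurry ψ) 2 (phaseMeasure V))
    (hψ' : MemLp (Function.uncurry ψ') 2 (phaseMeasure V)) :
    ∀ᵐ r ∂volume.restrict V,
      scalarFlux (fun r Ω => ψ r Ω - ψ' r Ω) r = scalarFlux ψ r - scalarFlux ψ' r := by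
  have : IsFiniteMeasure (volume.restrict V) := isFiniteMeasure_restrict.2 hVb.measure_lt_top.ne
  have : IsFiniteMeasure (phaseMeasure V) := by unfold phaseMeasure; infer_instance
  filter_upwards [(hψ.integrable one_le_two).prod_right_ae,
    (hψ'.integrable one_le_two).prod_right_ae] with r h h'
  simp only [Function.uncurry_apply_pair] at h h'
  simp only [scalarFlux]
  rw [integral_sub h h', mul_sub]

theorem ae_sqrt_le (hVo : IsOpen V) (hσm : ∀ r ∈ V, m ≤ σ r) :
    ∀ᵐ r ∂volume.restrict V, Real.sqrt m ≤ Real.sqrt (σ r) := by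
  filter_upwards [ae_restrict_mem hVo.measurableSet] with r hr
  exact Real.sqrt_le_sqrt (hσm r hr)

theorem eLpNorm_le_inv_sqrt_mul (hVo : IsOpen V) (hm : 0 < m) (hσm : ∀ r ∈ V, m ≤ σ r)
    (f : R3 → ℝ) :
    eLpNorm f 2 (volume.restrict V) ≤ ENNReal.ofReal (Real.sqrt m)⁻¹ *
      eLpNorm (fun r => Real.sqrt (σ r) * f r) 2 (volume.restrict V) := by
  refine eLpNorm_le_mul_eLpNorm_of_ae_le_mul ?_ 2
  filter_upwards [ae_sqrt_le hVo hσm] with r hr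
  rw [norm_mul, Real.norm_of_nonneg (Real.sqrt_nonneg _), ← mul_assoc]
  refine le_mul_of_one_le_left (norm_nonneg _) ?_
  rw [← div_eq_inv_mul, one_le_div (Real.sqrt_pos.2 hm)]
  exact hr

theorem eLpNorm_div_sqrt_le (hVo : IsOpen V) (hm : 0 < m) (hσm : ∀ r ∈ V, m ≤ σ r)
    (f : R3 → ℝ) :
    eLpNorm (fun r => f r / Real.sqrt (σ r)) 2 (volume.restrict V) ≤
      ENNReal.ofReal (Real.sqrt m)⁻¹ * eLpNorm f 2 (volume.restrict V) := by
  have hmpos := Real.sqrt_pos.2 hm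
  refine eLpNorm_le_mul_eLpNorm_of_ae_le_mul ?_ 2
  filter_upwards [ae_sqrt_le hVo hσm] with r hr
  rw [norm_div, Real.norm_of_nonneg (Real.sqrt_nonneg _), div_eq_inv_mul]
  gcongr

/-- The factor `1 / m` arises as `(√m)⁻¹` twice: once for removing the weight from the flux, once
for removing it from the source. -/
theorem normL2_scalarFlux_le (hVo : IsOpen V) (hVc : Convex ℝ V)
    (hVb : Bornology.IsBounded V) (hσ : AEMeasurable σ (volume.restrict V)) (hm : 0 < m)
    (hσb : ∀ r ∈ V, m ≤ σ r ∧ σ r ≤ M) (hq : MemLp q 2 (volume.restrict V))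
    (hsol : IsTransportSolution V σ q ψ) :
    normL2 V (scalarFlux ψ) ≤ 1 / m * normL2 V q := by
  have hle := (eLpNorm_le_inv_sqrt_mul hVo hm (fun r hr => (hσb r hr).1) (scalarFlux ψ)).trans
    (mul_le_mul_right ((eLpNorm_sqrt_mul_scalarFlux_le hVo hVc hVb hσ hm hσb
      hq.aestronglyMeasurable.aemeasurable hsol).trans
      (eLpNorm_div_sqrt_le hVo hm (fun r hr => (hσb r hr).1) q)) _)
  have h2 := ENNReal.toReal_mono (ENNReal.mul_ne_top ENNReal.ofReal_ne_top
    (ENNReal.mul_ne_top ENNReal.ofReal_ne_top hq.eLpNorm_ne_top)) hle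
  rw [ENNReal.toReal_mul, ENNReal.toReal_mul, ENNReal.toReal_ofReal (by positivity),
    ← mul_assoc, ← mul_inv, Real.mul_self_sqrt hm.le] at h2
  rw [one_div]
  exact h2

/-- Multiplication by the scattering ratio in the weighted norms. -/
theorem eLpNorm_scattering_le (hVo : IsOpen V) (hσ : AEMeasurable σ (volume.restrict V))
    (hm : 0 < m) (hσm : ∀ r ∈ V, m ≤ σ r) {f : R3 → ℝ}
    (hf : AEStronglyMeasurable f (volume.restrict V)) :
    eLpNorm (fun r => σS r * f r / Real.sqrt (σ r)) 2 (volume.restrict V) ≤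
      eLpNorm (fun r => σS r / σ r) ∞ (volume.restrict V) *
        eLpNorm (fun r => Real.sqrt (σ r) * f r) 2 (volume.restrict V) := by
  refine le_trans (le_of_eq (eLpNorm_congr_ae ?_)) (eLpNorm_smul_le_eLpNorm_top_mul_eLpNorm 2
    (hσ.sqrt.aestronglyMeasurable.mul hf) (fun r => σS r / σ r))
  filter_upwards [ae_restrict_mem hVo.measurableSet] with r hr
  have hpos := hm.trans_le (hσm r hr)
  have hs := Real.sqrt_pos.2 hpos
  simp only [Pi.smul_apply', smul_eq_mul, Pi.mul_apply]
  rw [div_eq_iff hs.ne']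
  calc σS r * f r = σS r / σ r * f r * σ r := by field_simp
    _ = σS r / σ r * f r * (Real.sqrt (σ r) * Real.sqrt (σ r)) := by
      rw [Real.mul_self_sqrt hpos.le]
    _ = _ := by ring

theorem MemLp.bounded_mul {α : Type*} [MeasurableSpace α] {μ : Measure α} {a f : α → ℝ} {C : ℝ}
    (hf : MemLp f 2 μ) (ha : AEMeasurable a μ) (hC : ∀ᵐ x ∂μ, |a x| ≤ C) :
    MemLp (fun x => a x * f x) 2 μ := by
  refine hf.of_le_mul (c := C) (ha.aestronglyMeasurable.mul hf.aestronglyMeasurable) ?_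
  filter_upwards [hC] with x hx
  rw [norm_mul]
  exact mul_le_mul_of_nonneg_right hx (norm_nonneg _)

theorem memLp_rte_source (hVo : IsOpen V) (hσS : AEMeasurable σS (volume.restrict V))
    (hSb : ∀ r ∈ V, |σS r| ≤ MS) (hQ : MemLp Q 2 (volume.restrict V)) {f : R3 → ℝ}
    (hf : MemLp f 2 (volume.restrict V)) :
    MemLp (fun r => σS r * f r + Q r) 2 (volume.restrict V) :=
  (MemLp.bounded_mul hf hσS
    ((ae_restrict_mem hVo.measurableSet).mono fun r hr => hSb r hr)).add hQ

/-- The map from the given flux to the new scalar flux contracts in the weighted norm. -/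
theorem eLpNorm_sqrt_mul_sub_scalarFlux_le (hVo : IsOpen V) (hVc : Convex ℝ V)
    (hVb : Bornology.IsBounded V) (hσ : AEMeasurable σ (volume.restrict V)) (hm : 0 < m)
    (hσb : ∀ r ∈ V, m ≤ σ r ∧ σ r ≤ M) (hσS : AEMeasurable σS (volume.restrict V))
    {f f' : R3 → ℝ} (hf : MemLp f 2 (volume.restrict V)) (hf' : MemLp f' 2 (volume.restrict V))
    (h : IsTransportSolution V σ (fun r => σS r * f r + Q r) ψ)
    (h' : IsTransportSolution V σ (fun r => σS r * f' r + Q r) ψ') :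
    eLpNorm (fun r => Real.sqrt (σ r) * (scalarFlux ψ r - scalarFlux ψ' r)) 2
        (volume.restrict V) ≤
      eLpNorm (fun r => σS r / σ r) ∞ (volume.restrict V) *
        eLpNorm (fun r => Real.sqrt (σ r) * (f r - f' r)) 2 (volume.restrict V) := by
  have hff := hf.sub hf'
  -- The common source `Q` cancels in the difference.
  have hsub : IsTransportSolution V σ (fun r => σS r * (f - f') r)
      (fun r Ω => ψ r Ω - ψ' r Ω) :=
    (h.sub hVo hVc hVb h').congr_source hVo hVb
      (Filter.Eventually.of_forall fun r => by simp only [Pi.sub_apply]; ring)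
  refine le_trans (le_of_eq (eLpNorm_congr_ae ?_)) ((eLpNorm_sqrt_mul_scalarFlux_le hVo hVc hVb
    hσ hm hσb (hσS.mul hff.aestronglyMeasurable.aemeasurable) hsub).trans
      (eLpNorm_scattering_le hVo hσ hm (fun r hr => (hσb r hr).1) hff.aestronglyMeasurable))
  filter_upwards [ae_scalarFlux_sub hVb h.memLp h'.memLp] with r hr
  rw [hr]

theorem memLp_sqrt_mul (hVo : IsOpen V) (hσ : AEMeasurable σ (volume.restrict V))
    (hσb : ∀ r ∈ V, m ≤ σ r ∧ σ r ≤ M) {f : R3 → ℝ} (hf : MemLp f 2 (volume.restrict V)) :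
    MemLp (fun r => Real.sqrt (σ r) * f r) 2 (volume.restrict V) :=
  MemLp.bounded_mul (C := Real.sqrt M) hf hσ.sqrt
    ((ae_restrict_mem hVo.measurableSet).mono fun r hr => by
      rw [abs_of_nonneg (Real.sqrt_nonneg _)]
      exact Real.sqrt_le_sqrt (hσb r hr).2)

theorem memLp_inv_sqrt_mul (hVo : IsOpen V) (hσ : AEMeasurable σ (volume.restrict V))
    (hm : 0 < m) (hσb : ∀ r ∈ V, m ≤ σ r ∧ σ r ≤ M) {f : R3 → ℝ}
    (hf : MemLp f 2 (volume.restrict V)) :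
    MemLp (fun r => (Real.sqrt (σ r))⁻¹ * f r) 2 (volume.restrict V) := by
  have hmpos := Real.sqrt_pos.2 hm
  refine MemLp.bounded_mul (C := (Real.sqrt m)⁻¹) hf hσ.sqrt.inv
    ((ae_sqrt_le hVo fun r hr => (hσb r hr).1).mono fun r hr => ?_)
  rw [abs_of_nonneg (inv_nonneg.2 (Real.sqrt_nonneg _))]
  gcongr

/-- The iteration runs on `h = √σ f` rather than on the flux `f`, so that the weighted norm in which
the map contracts is the ordinary norm of the complete space `Lp ℝ 2 μ`. -/
theorem exists_isRTESolution (hVo : IsOpen V) (hVc : Convex ℝ V)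
    (hVb : Bornology.IsBounded V) (hσ : AEMeasurable σ (volume.restrict V)) (hm : 0 < m)
    (hσb : ∀ r ∈ V, m ≤ σ r ∧ σ r ≤ M) (hσS : AEMeasurable σS (volume.restrict V))
    (hSb : ∀ r ∈ V, |σS r| ≤ MS) (hQ : MemLp Q 2 (volume.restrict V))
    (hc : eLpNorm (fun r => σS r / σ r) ∞ (volume.restrict V) < 1) :
    ∃ ψ, IsRTESolution V σ σS Q ψ := by
  set μ : Measure R3 := volume.restrict V with hμ
  have hsqrt : ∀ᵐ r ∂μ, 0 < Real.sqrt (σ r) := by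
    filter_upwards [ae_restrict_mem hVo.measurableSet] with r hr
    exact Real.sqrt_pos.2 (hm.trans_le (hσb r hr).1)
  have hflux : ∀ h : Lp ℝ 2 μ, MemLp (fun r => (Real.sqrt (σ r))⁻¹ * h r) 2 μ := fun h =>
    memLp_inv_sqrt_mul hVo hσ hm hσb (Lp.memLp h)
  have hex : ∀ h : Lp ℝ 2 μ, ∃ ψ, IsTransportSolution V σ
      (fun r => σS r * ((Real.sqrt (σ r))⁻¹ * h r) + Q r) ψ := fun h =>
    exists_isTransportSolution hVo hVc hVb hσ hm hσb
      (memLp_rte_source hVo hσS hSb hQ (hflux h))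
  choose Ψ hΨ using hex
  have hΦ : ∀ h, MemLp (fun r => Real.sqrt (σ r) * scalarFlux (Ψ h) r) 2 μ := fun h =>
    memLp_sqrt_mul hVo hσ hσb (memLp_scalarFlux (hΨ h).memLp)
  let F : Lp ℝ 2 μ → Lp ℝ 2 μ := fun h => (hΦ h).toLp _
  have hF : ContractingWith (eLpNorm (fun r => σS r / σ r) ∞ μ).toNNReal F := by
    refine ⟨?_, fun h k => ?_⟩
    · rw [← ENNReal.coe_lt_coe, ENNReal.coe_toNNReal hc.ne_top]
      exact hc
    · rw [ENNReal.coe_toNNReal hc.ne_top, Lp.edist_toLp_toLp, Lp.edist_def]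
      refine le_trans (le_of_eq (eLpNorm_congr_ae ?_)) ((eLpNorm_sqrt_mul_sub_scalarFlux_le hVo
        hVc hVb hσ hm hσb hσS (hflux h) (hflux k) (hΨ h) (hΨ k)).trans
          (le_of_eq (congrArg _ (eLpNorm_congr_ae ?_))))
      · exact Filter.Eventually.of_forall fun r => (mul_sub _ _ _).symm
      · filter_upwards [hsqrt] with r hr
        rw [Pi.sub_apply, ← mul_sub, mul_inv_cancel_left₀ hr.ne']
  obtain ⟨h, hfix, -⟩ := hF.exists_fixedPoint 0 (edist_ne_top _ _)
  -- At the fixed point the assumed flux agrees with the resulting one only almost everywhere, so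
  -- the source must be exchanged for an equivalent one.
  refine ⟨Ψ h, (hΨ h).congr_source hVo hVb ?_⟩
  have hae : h =ᵐ[μ] fun r => Real.sqrt (σ r) * scalarFlux (Ψ h) r := by
    have h1 := (hΦ h).coeFn_toLp
    have h2 : (hΦ h).toLp _ = h := hfix
    rwa [h2] at h1
  filter_upwards [hae, hsqrt] with r hr hpos
  rw [hr, inv_mul_cancel_left₀ hpos.ne']

theorem IsRTESolution.ae_unique (hVo : IsOpen V) (hVc : Convex ℝ V)
    (hVb : Bornology.IsBounded V) (hσ : AEMeasurable σ (volume.restrict V)) (hm : 0 < m)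
    (hσb : ∀ r ∈ V, m ≤ σ r ∧ σ r ≤ M) (hσS : AEMeasurable σS (volume.restrict V))
    (hc : eLpNorm (fun r => σS r / σ r) ∞ (volume.restrict V) < 1)
    (h : IsRTESolution V σ σS Q ψ) (h' : IsRTESolution V σ σS Q ψ') :
    Function.uncurry ψ =ᵐ[phaseMeasure V] Function.uncurry ψ' := by
  have hφ := memLp_scalarFlux h.memLp
  have hφ' := memLp_scalarFlux h'.memLp
  have hX : MemLp (fun r => Real.sqrt (σ r) * (scalarFlux ψ r - scalarFlux ψ' r)) 2
      (volume.restrict V) := memLp_sqrt_mul hVo hσ hσb (hφ.sub hφ')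
  have hle := eLpNorm_sqrt_mul_sub_scalarFlux_le hVo hVc hVb hσ hm hσb hσS hφ hφ' h h'
  have hzero : eLpNorm (fun r => Real.sqrt (σ r) * (scalarFlux ψ r - scalarFlux ψ' r)) 2
      (volume.restrict V) = 0 := by
    by_contra hne
    -- A finite nonzero norm cannot be at most `c < 1` times itself. The fluxes thus agree, and with
    -- them the sources, which leaves uniqueness for pure transport.
    refine absurd hle (not_le.2 ?_)
    calc _ < 1 * eLpNorm (fun r => Real.sqrt (σ r) * (scalarFlux ψ r - scalarFlux ψ' r)) 2
          (volume.restrict V) := ENNReal.mul_lt_mul_left hne hX.eLpNorm_ne_top hc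
      _ = _ := one_mul _
  rw [eLpNorm_eq_zero_iff hX.aestronglyMeasurable two_ne_zero] at hzero
  refine IsTransportSolution.ae_unique hVo hVc hVb hσ hm hσb h h' ?_
  filter_upwards [hzero, ae_restrict_mem hVo.measurableSet] with r hr hrV
  have h1 := (mul_eq_zero.1 hr).resolve_left (Real.sqrt_pos.2 (hm.trans_le (hσb r hrV).1)).ne'
  rw [sub_eq_zero.1 h1]

theorem IsRTESolution.normL2_scalarFlux_le (hVo : IsOpen V) (hVc : Convex ℝ V)
    (hVb : Bornology.IsBounded V) (hσ : AEMeasurable σ (volume.restrict V)) (hm : 0 < m)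
    (hσb : ∀ r ∈ V, m ≤ σ r ∧ σ r ≤ M) (hσS : AEMeasurable σS (volume.restrict V))
    (hQ : MemLp Q 2 (volume.restrict V))
    (hc : eLpNorm (fun r => σS r / σ r) ∞ (volume.restrict V) < 1)
    (h : IsRTESolution V σ σS Q ψ) :
    normL2 V (scalarFlux ψ) ≤
      1 / m * (1 - normLinf V (fun r => σS r / σ r))⁻¹ * normL2 V Q := by
  have hφ := memLp_scalarFlux h.memLp
  have hσm : ∀ r ∈ V, m ≤ σ r := fun r hr => (hσb r hr).1
  have hφm := hφ.aestronglyMeasurable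
  have hQm := hQ.aestronglyMeasurable
  have hX := memLp_sqrt_mul hVo hσ hσb hφ
  have hsum : eLpNorm (fun r => (σS r * scalarFlux ψ r + Q r) / Real.sqrt (σ r)) 2
      (volume.restrict V) ≤
      eLpNorm (fun r => σS r * scalarFlux ψ r / Real.sqrt (σ r)) 2 (volume.restrict V) +
        eLpNorm (fun r => Q r / Real.sqrt (σ r)) 2 (volume.restrict V) := by
    simp only [add_div]
    exact eLpNorm_add_le
      ((hσS.mul hφm.aemeasurable).div hσ.sqrt).aestronglyMeasurable
      (hQm.aemeasurable.div hσ.sqrt).aestronglyMeasurable one_le_two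
  have hle := (eLpNorm_sqrt_mul_scalarFlux_le hVo hVc hVb hσ hm hσb
    ((hσS.mul hφm.aemeasurable).add hQm.aemeasurable) h).trans (hsum.trans
      (add_le_add (eLpNorm_scattering_le hVo hσ hm hσm hφm) (eLpNorm_div_sqrt_le hVo hm hσm Q)))
  have hcX := ENNReal.mul_ne_top hc.ne_top hX.eLpNorm_ne_top
  have hcQ := ENNReal.mul_ne_top (ENNReal.ofReal_ne_top (r := (Real.sqrt m)⁻¹)) hQ.eLpNorm_ne_top
  have h1 := ENNReal.toReal_mono (ENNReal.add_ne_top.2 ⟨hcX, hcQ⟩) hle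
  have h2 := ENNReal.toReal_mono (ENNReal.mul_ne_top ENNReal.ofReal_ne_top hX.eLpNorm_ne_top)
    (eLpNorm_le_inv_sqrt_mul hVo hm hσm (scalarFlux ψ))
  rw [ENNReal.toReal_add hcX hcQ, ENNReal.toReal_mul, ENNReal.toReal_mul,
    ENNReal.toReal_ofReal (by positivity)] at h1
  rw [ENNReal.toReal_mul, ENNReal.toReal_ofReal (by positivity)] at h2
  have hc1 : normLinf V (fun r => σS r / σ r) < 1 := by
    have := ENNReal.toReal_strict_mono ENNReal.one_ne_top hc
    simpa [normLinf] using this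
  change _ ≤ normLinf V (fun r => σS r / σ r) * _ + _ * normL2 V Q at h1
  change normL2 V _ ≤ _ at h2
  set x := (eLpNorm (fun r => Real.sqrt (σ r) * scalarFlux ψ r) 2 (volume.restrict V)).toReal
  set c := normLinf V (fun r => σS r / σ r)
  -- From `x ≤ c x + (√m)⁻¹ ‖Q‖`, absorbing `c x` on the left.
  have h3 : x ≤ (1 - c)⁻¹ * ((Real.sqrt m)⁻¹ * normL2 V Q) := by
    rw [← div_eq_inv_mul, le_div_iff₀ (sub_pos.2 hc1)]
    linarith
  calc normL2 V (scalarFlux ψ) ≤ (Real.sqrt m)⁻¹ * x := h2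
    _ ≤ (Real.sqrt m)⁻¹ * ((1 - c)⁻¹ * ((Real.sqrt m)⁻¹ * normL2 V Q)) := by gcongr
    _ = (Real.sqrt m * Real.sqrt m)⁻¹ * (1 - c)⁻¹ * normL2 V Q := by rw [mul_inv]; ring
    _ = 1 / m * (1 - c)⁻¹ * normL2 V Q := by rw [Real.mul_self_sqrt hm.le, one_div]

/-- The ratio `σS / (σS + σA)` increases in `σS` and decreases in `σA`, so it is at most `MS / (MS +
MA) < 1`, uniformly on `V`. -/
theorem eLpNorm_scattering_ratio_lt_one {σA : R3 → ℝ} {MA : ℝ} (hVo : IsOpen V)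
    (hσ : ∀ r ∈ V, σ r = σS r + σA r) (hS : ∀ r ∈ V, 0 < σS r ∧ σS r ≤ MS) (hMA : 0 < MA)
    (hA : ∀ r ∈ V, MA ≤ σA r) :
    eLpNorm (fun r => σS r / σ r) ∞ (volume.restrict V) < 1 := by
  -- A point of `V` is needed to know that `MS > 0`.
  rcases V.eq_empty_or_nonempty with rfl | ⟨r₀, hr₀⟩
  · simp
  have hMS : 0 < MS := (hS r₀ hr₀).1.trans_le (hS r₀ hr₀).2
  have hle : eLpNorm (fun r => σS r / σ r) ∞ (volume.restrict V) ≤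
      ENNReal.ofReal (MS / (MS + MA)) := by
    rw [eLpNorm_exponent_top]
    refine eLpNormEssSup_le_of_ae_bound ?_
    filter_upwards [ae_restrict_mem hVo.measurableSet] with r hr
    have h1 := hS r hr
    have h2 := hA r hr
    have h3 : 0 < σS r + σA r := by linarith
    rw [hσ r hr, Real.norm_of_nonneg (div_nonneg h1.1.le h3.le),
      div_le_div_iff₀ h3 (by linarith)]
    nlinarith [mul_le_mul h1.2 h2 hMA.le hMS.le]
  refine hle.trans_lt ?_
  rw [← ENNReal.ofReal_one, ENNReal.ofReal_lt_ofReal_iff one_pos, div_lt_one (by linarith)]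
  linarith

end RadiativeTransport

end Transport

open Transport in
theorem mainTheorem3
    (V : Set R3) (hVopen : IsOpen V) (hVconv : Convex ℝ V) (hVbdd : Bornology.IsBounded V)
    (σ σS σA : R3 → ℝ)
    (hσS : AEMeasurable σS (volume.restrict V)) (hσA : AEMeasurable σA (volume.restrict V))
    (hσ : ∀ r ∈ V, σ r = σS r + σA r)
    (σSmin σSmax : ℝ) (hσSmin : 0 < σSmin) (hσSbd : ∀ r ∈ V, σSmin ≤ σS r ∧ σS r ≤ σSmax)
    (σAmin σAmax : ℝ) (hσAmin : 0 < σAmin) (hσAbd : ∀ r ∈ V, σAmin ≤ σA r ∧ σA r ≤ σAmax)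
    (σmin : ℝ) (hσmin : 0 < σmin) (hσbd : ∀ r ∈ V, σmin ≤ σ r) :
    -- (i) the pure transport problem
    (∀ g : R3 → ℝ, MemLp g 2 (volume.restrict V) →
      (∃ ψ, IsTransportSolution V σ g ψ ∧
        ∀ ψ', IsTransportSolution V σ g ψ' →
          Function.uncurry ψ' =ᵐ[phaseMeasure V] Function.uncurry ψ) ∧
      ∀ ψ, IsTransportSolution V σ g ψ →
        MemLp (scalarFlux ψ) 2 (volume.restrict V) ∧
        normL2 V (scalarFlux ψ) ≤ 1 / σmin * normL2 V g) ∧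
    -- (ii) the radiative transport equation
    normLinf V (fun r => σS r / σ r) < 1 ∧
    (∀ Q : R3 → ℝ, MemLp Q 2 (volume.restrict V) →
      (∃ ψ, IsRTESolution V σ σS Q ψ ∧
        ∀ ψ', IsRTESolution V σ σS Q ψ' →
          Function.uncurry ψ' =ᵐ[phaseMeasure V] Function.uncurry ψ) ∧
      ∀ ψ, IsRTESolution V σ σS Q ψ →
        MemLp (scalarFlux ψ) 2 (volume.restrict V) ∧
        normL2 V (scalarFlux ψ) ≤
          1 / σmin * (1 - normLinf V (fun r => σS r / σ r))⁻¹ * normL2 V Q) := by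
  have hσb : ∀ r ∈ V, σmin ≤ σ r ∧ σ r ≤ σSmax + σAmax := fun r hr =>
    ⟨hσbd r hr, by rw [hσ r hr]; exact add_le_add (hσSbd r hr).2 (hσAbd r hr).2⟩
  have hσm : AEMeasurable σ (volume.restrict V) := by
    refine (hσS.add hσA).congr ?_
    filter_upwards [ae_restrict_mem hVopen.measurableSet] with r hr using (hσ r hr).symm
  have hSpos : ∀ r ∈ V, 0 < σS r ∧ σS r ≤ σSmax := fun r hr =>
    ⟨hσSmin.trans_le (hσSbd r hr).1, (hσSbd r hr).2⟩
  have hSabs : ∀ r ∈ V, |σS r| ≤ σSmax := fun r hr => by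
    rw [abs_of_pos (hSpos r hr).1]
    exact (hSpos r hr).2
  have hc := eLpNorm_scattering_ratio_lt_one hVopen hσ hSpos hσAmin fun r hr => (hσAbd r hr).1
  refine ⟨fun g hg => ⟨?_, fun ψ hψ => ⟨memLp_scalarFlux hψ.memLp,
    normL2_scalarFlux_le hVopen hVconv hVbdd hσm hσmin hσb hg hψ⟩⟩, ?_,
    fun Q hQ => ⟨?_, fun ψ hψ => ⟨memLp_scalarFlux hψ.memLp,
    hψ.normL2_scalarFlux_le hVopen hVconv hVbdd hσm hσmin hσb hσS hQ hc⟩⟩⟩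
  · obtain ⟨ψ, hψ⟩ := exists_isTransportSolution hVopen hVconv hVbdd hσm hσmin hσb hg
    exact ⟨ψ, hψ, fun ψ' hψ' => hψ'.ae_unique hVopen hVconv hVbdd hσm hσmin hσb hψ
      Filter.EventuallyEq.rfl⟩
  · simpa [normLinf] using ENNReal.toReal_strict_mono ENNReal.one_ne_top hc
  · obtain ⟨ψ, hψ⟩ := exists_isRTESolution hVopen hVconv hVbdd hσm hσmin hσb hσS hSabs hQ hc
    exact ⟨ψ, hψ, fun ψ' hψ' => hψ'.ae_unique hVopen hVconv hVbdd hσm hσmin hσb hσS hc hψ⟩
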